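/- An $(I/O)$-transducer is $\mathcal T=\langle I,O,S,s_0,\eta,\tau\rangle$ with a finite state set $S$, initial state $s_0$, transition function $\eta:S\times 2^I\to S$ and labeling $\tau:S\to 2^O$; its size is $|S|$. On $w_I=i_0i_1\cdots\in(2^I)^\omega$ it generates $\mathcal T(w_I)=(i_0\cup o_0)(i_1\cup o_1)\cdots\in(2^{I\cup O})^\omega$, where $o_j=\tau(s_{j+1})$ and $s_{j+1}=\eta(s_j,i_j)$. For $\mathcal H\subseteq I\cup O$, let $\mathsf{noise}_{\mathcal H}(w)$ be the set of words in $(2^{I\cup O})^\omega$ that agree with $w$ on all signals outside $\mathcal H$. The transducer $\mathcal T$ *$\mathcal H$-hides* a deterministic Büchi word automaton (DBW) $\mathcal D$ over $2^{I\cup O}$, whose transition function may be partial, if for every $w_I\in(2^I)^\omega$ there are $w^+,w^-\in\mathsf{noise}_{\mathcal H}(\mathcal T(w_I))$ with $w^+\in L(\mathcal D)$ and $w^-\notin L(\mathcal D)$. **Theorem.** Given two disjoint finite sets $I$ and $O$, a DBW $\mathcal D$ over $2^{I\cup O}$ (presented explicitly, with the table of its transition function), a set $\mathcal H\subseteq I\cup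 O$ of hidden signals, and a bound $n\ge 1$ represented in unary, deciding whether there exists an $(I/O)$-transducer of size at most $n$ that $\mathcal H$-hides $\mathcal D$ is PSPACE-hard (under polynomial-time many-one reductions). The problem is PSPACE-hard already when it is restricted to inputs with $n=1$. -/

import Mathlib

open Turing

/-! ### Signals, words, transducers, hiding -/

/-- `2^P`: the truth assignments to a set `P` of signals. -/
abbrev Assignment (P : Type) : Type := P → Bool

/-- An `(I/O)`-transducer with state set `S`; it outputs the label of the state it enters. -/
structure Transducer (I O S : Type) where
  start : S
  next : S → Assignment I → S
  label : S → Assignment O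

namespace Transducer

variable {I O S : Type}

/-- The state reached after reading the first `j` letters of the input word. -/
def stateAfter (T : Transducer I O S) (w : ℕ → Assignment I) : ℕ → S
  | 0 => T.start
  | j + 1 => T.next (stateAfter T w j) (w j)

/-- The computation `T(w) = (i₀ ∪ o₀)(i₁ ∪ o₁)…`, where `oⱼ` is the label of the state reached
after reading `i₀ … iⱼ`. The disjoint union of the signal sets is the type `I ⊕ O`. -/
def computation (T : Transducer I O S) (w : ℕ → Assignment I) : ℕ → Assignment (I ⊕ O) :=
  fun j => Sum.elim (w j) (T.label (T.stateAfter w (j + 1)))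

end Transducer

/-- All words that agree with `w` on the visible signals, that is, on those outside `H`. -/
def noise {P : Type} (H : Set P) (w : ℕ → Assignment P) : Set (ℕ → Assignment P) :=
  {w' | ∀ j, ∀ p, p ∉ H → w' j p = w j p}

/-- The transducer `T` `H`-hides the secret language `L`. -/
def Transducer.Hides {I O S : Type} (T : Transducer I O S) (H : Set (I ⊕ O))
    (L : Set (ℕ → Assignment (I ⊕ O))) : Prop :=
  ∀ w : ℕ → Assignment I,
    (∃ w' ∈ noise H (T.computation w), w' ∈ L) ∧ (∃ w' ∈ noise H (T.computation w), w' ∉ L)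

/-! ### Deterministic Büchi word automata -/

/-- A deterministic Büchi automaton over the alphabet `A` with state set `Q`. The transition
function is partial: `none` plays the role of `⊥`. -/
structure DBW (A Q : Type) where
  start : Q
  next : Q → A → Option Q
  accept : Finset Q

namespace DBW

variable {A Q : Type}

def IsRun (D : DBW A Q) (w : ℕ → A) (r : ℕ → Q) : Prop :=
  r 0 = D.start ∧ ∀ i, D.next (r i) (w i) = some (r (i + 1))

/-- The states that `r` visits infinitely often. -/
def infStates (r : ℕ → Q) : Set Q := {q | {i | r i = q}.Infinite}

def language (D : DBW A Q) : Set (ℕ → A) :=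
  {w | ∃ r, D.IsRun w r ∧ (infStates r ∩ (D.accept : Set Q)).Nonempty}

end DBW

/-! ### The decision problem and its inputs -/

/-- An input: numbers of input and output signals, a DBW (the secret) with `numStates` states over
assignments to all the signals, a set of hidden signals, and a bound `n ≥ 1`. -/
structure HidingInput where
  numIn : ℕ
  numOut : ℕ
  numStates : ℕ
  secret : DBW (Assignment (Fin numIn ⊕ Fin numOut)) (Fin numStates)
  hidden : Finset (Fin numIn ⊕ Fin numOut)
  bound : ℕ
  one_le_bound : 1 ≤ bound

/-- The question: is there a transducer with at most `bound` states that hides the secret? -/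
def HidingInput.Holds (x : HidingInput) : Prop :=
  ∃ (S : Type) (_ : Fintype S) (T : Transducer (Fin x.numIn) (Fin x.numOut) S),
    Fintype.card S ≤ x.bound ∧ T.Hides (x.hidden : Set (Fin x.numIn ⊕ Fin x.numOut))
      x.secret.language

/-- Unary code of a number. -/
def unary (n : ℕ) : List Bool := List.replicate n true ++ [false]

/-- The `k`-th assignment to `a + b` signals: signal number `i` gets the `i`-th binary digit
of `k`. -/
def letter (a b k : ℕ) : Assignment (Fin a ⊕ Fin b) :=
  Sum.elim (fun i => k.testBit i) (fun j => k.testBit (a + j))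

/-- Code of the value of a partial transition function. -/
def targetCode {m : ℕ} : Option (Fin m) → ℕ
  | none => 0
  | some q => q + 1

/-- The binary string that represents an input: the numbers of signals and of states, the initial
state, one bit per state (acceptance), one bit per signal (hidden or not), the bound in unary,
and the full table of the transition function. -/
def HidingInput.encode (x : HidingInput) : List Bool :=
  unary x.numIn ++ (unary x.numOut ++ (unary x.numStates ++ (unary x.secret.start ++
  (List.ofFn (fun q => decide (q ∈ x.secret.accept)) ++
  (List.ofFn (fun i => decide (Sum.inl i ∈ x.hidden)) ++
  (List.ofFn (fun j => decide (Sum.inr j ∈ x.hidden)) ++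
  (unary x.bound ++
  (List.finRange x.numStates ×ˢ List.range (2 ^ (x.numIn + x.numOut))).flatMap
    (fun qk => unary (targetCode (x.secret.next qk.1 (letter x.numIn x.numOut qk.2)))))))))))

theorem unary_append_inj {a b : ℕ} {s t : List Bool} (h : unary a ++ s = unary b ++ t) :
    a = b ∧ s = t := by
  induction a generalizing b with
  | zero =>
    cases b with
    | zero => simpa [unary] using h
    | succ b => simp [unary, List.replicate_succ] at h
  | succ a ih =>
    cases b with
    | zero => simp [unary, List.replicate_succ] at h
    | succ b =>
      have := @ih b (by simpa [unary, List.replicate_succ] using h)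
      exact ⟨by omega, this.2⟩

theorem flatMap_unary_inj {α : Type} {f g : α → ℕ} {l : List α}
    (h : l.flatMap (fun a => unary (f a)) = l.flatMap (fun a => unary (g a))) :
    ∀ a ∈ l, f a = g a := by
  induction l with
  | nil => simp
  | cons c l ih =>
    rw [List.flatMap_cons, List.flatMap_cons] at h
    obtain ⟨h1, h2⟩ := unary_append_inj h
    intro a ha
    rcases List.mem_cons.1 ha with rfl | ha
    · exact h1
    · exact ih h2 a ha

theorem exists_letter (a b : ℕ) (s : Assignment (Fin a ⊕ Fin b)) :
    ∃ k < 2 ^ (a + b), letter a b k = s := by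
  refine ⟨Nat.ofBits (fun i : Fin (a + b) => s (finSumFinEquiv.symm i)), Nat.ofBits_lt_two_pow _, ?_⟩
  funext p
  rcases p with i | j
  · have hi : (i : ℕ) < a + b := by omega
    simp only [letter, Sum.elim_inl, Nat.testBit_ofBits_lt _ _ hi]
    exact congrArg s (finSumFinEquiv_symm_apply_castAdd i)
  · have hj : a + (j : ℕ) < a + b := by omega
    simp only [letter, Sum.elim_inr, Nat.testBit_ofBits_lt _ _ hj]
    exact congrArg s (finSumFinEquiv_symm_apply_natAdd j)

theorem targetCode_injective {m : ℕ} : Function.Injective (@targetCode m) := by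
  rintro (_ | p) (_ | q) h <;> simp_all [targetCode, Fin.ext_iff]

/-- Different inputs have different representations. -/
theorem HidingInput.encode_injective : Function.Injective HidingInput.encode := by
  rintro ⟨a, b, m, ⟨q₀, δ, F⟩, H, n, hn⟩ ⟨a', b', m', ⟨q₀', δ', F'⟩, H', n', hn'⟩ h
  simp only [HidingInput.encode] at h
  obtain ⟨rfl, h⟩ := unary_append_inj h
  obtain ⟨rfl, h⟩ := unary_append_inj h
  obtain ⟨rfl, h⟩ := unary_append_inj h
  obtain ⟨hq, h⟩ := unary_append_inj h
  obtain rfl := Fin.ext hq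
  obtain ⟨hF, h⟩ := List.append_inj h (by simp)
  obtain ⟨hI, h⟩ := List.append_inj h (by simp)
  obtain ⟨hO, h⟩ := List.append_inj h (by simp)
  obtain ⟨rfl, h⟩ := unary_append_inj h
  have hF' : F = F' := by
    ext q
    simpa using congrFun (List.ofFn_injective hF) q
  have hH' : H = H' := by
    ext p
    rcases p with i | j
    · simpa using congrFun (List.ofFn_injective hI) i
    · simpa using congrFun (List.ofFn_injective hO) j
  have hδ : δ = δ' := by
    funext q s
    obtain ⟨k, hk, rfl⟩ := exists_letter a b s
    exact targetCode_injective (flatMap_unary_inj h (q, k) (by simp [hk]))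
  subst hF' hH' hδ
  rfl

/-! ### Turing machines, polynomial space, hardness -/

/-- A deterministic Turing machine with one tape that is infinite to the right, with input
alphabet `Bool`. It halts when the transition function is undefined, and it accepts if it
halts in a state of `accept`. -/
structure TapeMachine where
  Q : Type
  Γ : Type
  [finQ : Fintype Q]
  [finΓ : Fintype Γ]
  blank : Γ
  sym : Bool → Γ
  sym_injective : Function.Injective sym
  sym_ne_blank : ∀ b, sym b ≠ blank
  start : Q
  accept : Set Q
  next : Q → Γ → Option (Q × Γ × Dir)

namespace TapeMachine

structure Cfg (M : TapeMachine) where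
  state : M.Q
  head : ℕ
  tape : ℕ → M.Γ

/-- The new position of the head. A left move on the leftmost cell leaves the head there. -/
def move : Dir → ℕ → ℕ
  | Dir.left, i => i - 1
  | Dir.right, i => i + 1

def step (M : TapeMachine) (c : M.Cfg) : Option M.Cfg :=
  (M.next c.state (c.tape c.head)).map fun t =>
    ⟨t.1, move t.2.2 c.head, Function.update c.tape c.head t.2.1⟩

/-- The input is written on the leftmost cells; all other cells are blank. -/
def init (M : TapeMachine) (x : List Bool) : M.Cfg :=
  ⟨M.start, 0, fun i => (x[i]?).elim M.blank M.sym⟩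

/-- On every input `x`, the machine scans only the first `s |x|` cells, halts, and accepts iff
`x ∈ L`. -/
def DecidesInSpace (M : TapeMachine) (L : Language Bool) (s : ℕ → ℕ) : Prop :=
  ∀ x : List Bool,
    (∀ c, StateTransition.Reaches M.step (M.init x) c → c.head < s x.length) ∧
    ∃ c, StateTransition.Reaches M.step (M.init x) c ∧ M.step c = none ∧
      (c.state ∈ M.accept ↔ x ∈ L)

end TapeMachine

/-- The class PSPACE of languages over `{0, 1}`. -/
def PSPACE : Set (Language Bool) :=
  {L | ∃ (M : TapeMachine) (p : Polynomial ℕ), M.DecidesInSpace L (fun n => p.eval n)}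

/-- The decision problem with the set `α` of inputs, represented as binary strings by `enc`, and
the set `P` of positive inputs is PSPACE-hard: every language in PSPACE is reducible to it by a
function that is computable in polynomial time. -/
def PSPACEHard {α : Type} (enc : α → List Bool) (P : α → Prop) : Prop :=
  ∀ L ∈ PSPACE, ∃ f : List Bool → α,
    Nonempty (TM2ComputableInPolyTime (id : List Bool → List Bool) enc f) ∧
      ∀ x, x ∈ L ↔ P (f x)

/-! Let `M` decide a language within S = (|x| + 2)^k cells. An input word is read as a sequence of
claims about the symbols that the head of `M` scans on `x`; each claim also says whether the scanned
cell is the leftmost. The only output signal is the only hidden one, so the transducer has no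
influence, and one state is as good as many: hiding means that every word of claims has an accepted
and a rejected completion by a hidden word.

The hidden word selects a cell to watch. The secret automaton trusts the claims about all other
cells, and tracks the state of `M`, the head position relative to the watched cell, and the content
of that cell. It accepts when a claim about the watched cell is wrong or the simulated machine
accepts, and gets stuck when that machine rejects. If `x` is in the language, a word of claims
either has a first false claim before halting, caught by watching the cell concerned, or leads to
acceptance or a false claim at the halting time (`exists_choice`). Otherwise the true claims defeat
every selection (`exists_forall_choice`). Never selecting a cell is always rejected.

The automaton must know the head position when it selects. Hence the computation is preceded by a
walk of the head from cell S - 1 to cell 0, and the cell on offer is always the one under the head.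

The numbers of records and letters depend on `M` only, and the code of each target state is affine
in S and a block number, with coefficients fixed by `M`. So nested loops write the instance
(`encode_hidingInput`); they are stack programs, which compile to machines without loss of time
(`Run.exists_iterate`). -/

/-! ### Structured stack programs -/

/-- Structured programs that work on stacks of bits. `popCase k f` pops the stack `k` and goes on
with the program for the result; `drain k f` pops `k` until it is empty, and runs `f b` for every
bit `b` that it pops. -/
inductive StackProg (K : Type) : Type
  | skip : StackProg K
  | push (k : K) (b : Bool) : StackProg K
  | seq (p q : StackProg K) : StackProg K
  | popCase (k : K) (f : Option Bool → StackProg K) : StackProg K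
  | drain (k : K) (f : Bool → StackProg K) : StackProg K

namespace StackProg

variable {K : Type}

/-- The control points of a program. -/
def Label : StackProg K → Type
  | skip => Unit
  | push _ _ => Unit
  | seq p q => p.Label ⊕ q.Label
  | popCase _ f => Option (Σ o, (f o).Label)
  | drain _ f => Option (Σ b, (f b).Label)

@[reducible] noncomputable def fintypeLabel : ∀ p : StackProg K, Fintype p.Label
  | skip => inferInstanceAs (Fintype Unit)
  | push _ _ => inferInstanceAs (Fintype Unit)
  | seq p q =>
    have := p.fintypeLabel
    have := q.fintypeLabel
    inferInstanceAs (Fintype (p.Label ⊕ q.Label))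
  | popCase _ f =>
    have := fun o => (f o).fintypeLabel
    inferInstanceAs (Fintype (Option (Σ o, (f o).Label)))
  | drain _ f =>
    have := fun b => (f b).fintypeLabel
    inferInstanceAs (Fintype (Option (Σ b, (f b).Label)))

/-- The control point at which a program starts. -/
def entry : ∀ p : StackProg K, p.Label
  | skip => ()
  | push _ _ => ()
  | seq p _ => Sum.inl p.entry
  | popCase _ _ => none
  | drain _ _ => none

/-- The code of a program whose control points are embedded into `Λ` and that continues at
`ex` when it is done. -/
def code {Λ : Type} : ∀ p : StackProg K, (p.Label → Λ) → Λ → p.Label →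
    TM2.Stmt (fun _ : K => Bool) Λ (Option Bool)
  | skip, _, ex, _ => .goto fun _ => ex
  | push k b, _, ex, _ => .push k (fun _ => b) (.goto fun _ => ex)
  | seq p q, emb, _, .inl l => p.code (fun l => emb (.inl l)) (emb (.inr q.entry)) l
  | seq _ q, emb, ex, .inr l => q.code (fun l => emb (.inr l)) ex l
  | popCase k f, emb, _, none =>
    .pop k (fun _ o => o) (.goto fun o => emb (some ⟨o, (f o).entry⟩))
  | popCase _ f, emb, ex, some ⟨o, l⟩ => (f o).code (fun l => emb (some ⟨o, l⟩)) ex l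
  | drain k f, emb, ex, none =>
    .pop k (fun _ o => o) (.goto fun o => o.elim ex fun b => emb (some ⟨b, (f b).entry⟩))
  | drain _ f, emb, _, some ⟨b, l⟩ => (f b).code (fun l => emb (some ⟨b, l⟩)) (emb none) l

variable [DecidableEq K]

/-- `Run p s s' t`: started with the stacks `s`, the program `p` ends with the stacks `s'` within
`t` steps. -/
inductive Run : StackProg K → (K → List Bool) → (K → List Bool) → ℕ → Prop
  | skip (s) : Run skip s s 1
  | push (k b s) : Run (push k b) s (Function.update s k (b :: s k)) 1
  | seq {p q s s' s'' t t'} : Run p s s' t → Run q s' s'' t' → Run (seq p q) s s'' (t + t')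
  | popCase {k f s s' t} : Run (f (s k).head?) (Function.update s k (s k).tail) s' t →
      Run (popCase k f) s s' (t + 1)
  | drain_nil {k f s} : s k = [] → Run (drain k f) s s 1
  | drain_cons {k f s s' s'' b l t t'} : s k = b :: l →
      Run (f b) (Function.update s k l) s' t → Run (drain k f) s' s'' t' →
      Run (drain k f) s s'' (t + t' + 1)
  | mono {p s s' t t'} : Run p s s' t → t ≤ t' → Run p s s' t'

/-- The code of a program does what the program does, in the same time. -/
theorem Run.exists_iterate {p : StackProg K} {s s' : K → List Bool} {t : ℕ} (h : p.Run s s' t) :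
    ∀ {Λ : Type} (m : Λ → TM2.Stmt (fun _ : K => Bool) Λ (Option Bool)) (emb : p.Label → Λ)
      (ex : Λ), (∀ l, m (emb l) = p.code emb ex l) → ∀ v, ∃ v', ∃ n ≤ t,
        (flip bind (TM2.step m))^[n] (some ⟨some (emb p.entry), v, s⟩) =
          some ⟨some ex, v', s'⟩ := by
  -- Embedding and exit vary in the induction: the first half of `seq` exits to the entry of the
  -- second, and a loop body exits to the head of its loop.
  induction h with
  | skip s =>
    intro Λ m emb ex hm v
    exact ⟨v, 1, le_rfl, by simp [flip, hm, code]⟩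
  | push k b s =>
    intro Λ m emb ex hm v
    exact ⟨v, 1, le_rfl, by simp [flip, hm, code]⟩
  | @seq p q s s' s'' t t' _ _ ih ih' =>
    intro Λ m emb ex hm v
    obtain ⟨v', n, hn, h⟩ := ih m (fun l => emb (.inl l)) (emb (.inr q.entry))
      (fun l => hm (.inl l)) v
    obtain ⟨v'', n', hn', h'⟩ := ih' m (fun l => emb (.inr l)) ex (fun l => hm (.inr l)) v'
    refine ⟨v'', n' + n, by omega, ?_⟩
    rw [Function.iterate_add_apply]
    exact (congrArg _ h).trans h'
  | @popCase k f s s' t _ ih =>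
    intro Λ m emb ex hm v
    obtain ⟨v', n, hn, h⟩ := ih m (fun l => emb (some ⟨_, l⟩)) ex (fun l => hm (some ⟨_, l⟩))
      (s k).head?
    refine ⟨v', n + 1, by omega, ?_⟩
    have h0 : m (emb none) = .pop k (fun _ o => o)
      (.goto fun o => emb (some ⟨o, (f o).entry⟩)) := hm none
    rw [Function.iterate_succ_apply, ← h]
    simp [flip, h0, entry]
  | @drain_nil k f s hs =>
    intro Λ m emb ex hm v
    refine ⟨none, 1, le_rfl, ?_⟩
    have : Function.update s k [] = s := by rw [← hs, Function.update_eq_self]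
    have h0 : m (emb none) = .pop k (fun _ o => o)
      (.goto fun o => o.elim ex fun b => emb (some ⟨b, (f b).entry⟩)) := hm none
    simp [flip, h0, entry, hs, this]
  | @drain_cons k f s s' s'' b l t t' hs _ _ ih ih' =>
    intro Λ m emb ex hm v
    obtain ⟨v', n, hn, h⟩ := ih m (fun l => emb (some ⟨b, l⟩)) (emb none)
      (fun l => hm (some ⟨b, l⟩)) (some b)
    obtain ⟨v'', n', hn', h'⟩ := ih' m emb ex hm v'
    refine ⟨v'', n' + (n + 1), by omega, ?_⟩
    rw [Function.iterate_add_apply, Function.iterate_succ_apply, ← h']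
    congr 1
    have h0 : m (emb none) = .pop k (fun _ o => o)
      (.goto fun o => o.elim ex fun b => emb (some ⟨b, (f b).entry⟩)) := hm none
    rw [show some (TM2.Cfg.mk (some (emb (drain k f).entry)) v' s') = _ from h.symm]
    simp [flip, h0, entry, hs]
  | mono _ hle ih =>
    intro Λ m emb ex hm v
    obtain ⟨v', n, hn, h⟩ := ih m emb ex hm v
    exact ⟨v', n, hn.trans hle, h⟩

/-- The machine that executes a program. -/
noncomputable def machine [Fintype K] (p : StackProg K) (k₀ k₁ : K) : FinTM2 where
  K := K
  k₀ := k₀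
  k₁ := k₁
  Γ := fun _ => Bool
  Λ := Option p.Label
  main := some p.entry
  ΛFin := have := p.fintypeLabel; inferInstance
  σ := Option Bool
  initialState := none
  Γk₀Fin := inferInstanceAs (Fintype Bool)
  -- A halting configuration must carry the initial value of the local variable; the extra step that
  -- resets it accounts for `T + 1` below.
  m := fun l => l.elim (.load (fun _ => none) .halt) (p.code some none)

/-- A function is computable in polynomial time if a stack program computes it in polynomial
time. -/
theorem nonempty_computableInPolyTime [Fintype K] (p : StackProg K) (k₀ k₁ : K) {β : Type}
    {enc : β → List Bool} {f : List Bool → β} (T : Polynomial ℕ)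
    (h : ∀ x : List Bool, p.Run (Function.update (fun _ => []) k₀ x)
      (Function.update (fun _ => []) k₁ (enc (f x))) (T.eval x.length)) :
    Nonempty (TM2ComputableInPolyTime (id : List Bool → List Bool) enc f) := by
  refine ⟨⟨⟨p.machine k₀ k₁, Equiv.refl Bool, Equiv.refl Bool⟩, T + 1, fun x => ?_⟩⟩
  have hx := (h x).exists_iterate (p.machine k₀ k₁).m some none (fun l => rfl) none
  choose v n hn hv using hx
  refine ⟨⟨n + 1, ?_⟩, by simpa using hn⟩
  have hi : initList (p.machine k₀ k₁) (List.map (Equiv.refl Bool).invFun (id x)) =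
      ⟨some (some p.entry), none, Function.update (fun _ => []) k₀ x⟩ := by
    refine (congrArg (initList (p.machine k₀ k₁)) (List.map_id (x))).trans ?_
    refine congrArg (TM2.Cfg.mk _ _) (funext fun (j : K) => ?_)
    by_cases hj : j = k₀
    · subst hj
      exact (dif_pos rfl).trans (Function.update_self (β := fun _ => List Bool) _ _ _).symm
    · exact (dif_neg hj).trans (Function.update_of_ne (β := fun _ => List Bool) hj x fun _ => []).symm
  have ho : haltList (p.machine k₀ k₁) (List.map (Equiv.refl Bool).invFun (enc (f x))) =
      ⟨none, none, Function.update (fun _ => []) k₁ (enc (f x))⟩ := by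
    refine (congrArg (haltList (p.machine k₀ k₁)) (List.map_id (enc (f x)))).trans ?_
    refine congrArg (TM2.Cfg.mk _ _) (funext fun (j : K) => ?_)
    by_cases hj : j = k₁
    · subst hj
      exact (dif_pos rfl).trans (Function.update_self (β := fun _ => List Bool) _ _ _).symm
    · exact (dif_neg hj).trans (Function.update_of_ne (β := fun _ => List Bool) hj (enc (f x)) fun _ => []).symm
  rw [Option.map_some]
  erw [hi, ho]
  rw [Function.iterate_succ_apply']
  refine (congrArg _ hv).trans ?_
  rfl

end StackProg

/-! ### Finite runs of deterministic Büchi automata -/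

namespace DBW

variable {A B Q R : Type}

/-- The state after `n` letters, if the automaton has not got stuck before. -/
def runTo (D : DBW A Q) (w : ℕ → A) : ℕ → Option Q
  | 0 => some D.start
  | n + 1 => (D.runTo w n).bind fun q => D.next q (w n)

theorem IsRun.runTo_eq {D : DBW A Q} {w : ℕ → A} {r : ℕ → Q} (h : D.IsRun w r) (n : ℕ) :
    D.runTo w n = some (r n) := by
  induction n with
  | zero => rw [runTo, h.1]
  | succ n ih => rw [runTo, ih, Option.bind_some, h.2]

theorem notMem_language_of_runTo_eq_none {D : DBW A Q} {w : ℕ → A} {n : ℕ}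
    (h : D.runTo w n = none) : w ∉ D.language := by
  rintro ⟨r, hr, -⟩
  simp [hr.runTo_eq n] at h

/-- A stuck run stays stuck, so reaching the sink shows that the run is total; from then on it never
leaves an accepting state. -/
theorem mem_language_of_runTo_eq_sink {D : DBW A Q} {w : ℕ → A} {n : ℕ} {q : Q}
    (h : D.runTo w n = some q) (hq : q ∈ D.accept) (hs : ∀ a, D.next q a = some q) :
    w ∈ D.language := by
  have hge : ∀ m, D.runTo w (n + m) = some q := by
    intro m
    induction m with
    | zero => exact h
    | succ m ih => rw [← add_assoc, runTo, ih, Option.bind_some, hs]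
  have hsome : ∀ m, ∃ r, D.runTo w m = some r := by
    intro m
    by_contra hm
    have hnone : D.runTo w m = none := by
      cases hr : D.runTo w m with
      | none => rfl
      | some r => exact absurd ⟨r, hr⟩ hm
    have : ∀ k, D.runTo w (m + k) = none := by
      intro k
      induction k with
      | zero => exact hnone
      | succ k ih => rw [← add_assoc, runTo, ih, Option.bind_none]
    have h1 := this n
    rw [add_comm, hge] at h1
    simp at h1
  choose r hr using hsome
  refine ⟨r, ⟨?_, fun i => ?_⟩, q, ?_, hq⟩
  · have := hr 0
    rw [runTo] at this
    exact (Option.some.inj this).symm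
  · have := hr (i + 1)
    rwa [runTo, hr, Option.bind_some] at this
  · refine Set.infinite_of_injective_forall_mem (add_right_injective n) fun m => ?_
    have := hr (n + m)
    rw [hge] at this
    exact (Option.some.inj this).symm

/-- Reads the letter `f b` in place of `b`, and renames the states. -/
def relabel (D : DBW A Q) (f : B → A) (e : Q ≃ R) : DBW B R where
  start := e D.start
  next r b := (D.next (e.symm r) (f b)).map e
  accept := D.accept.map e.toEmbedding

theorem mem_language_relabel (D : DBW A Q) (f : B → A) (e : Q ≃ R) (w : ℕ → B) :
    w ∈ (D.relabel f e).language ↔ (fun i => f (w i)) ∈ D.language := by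
  constructor
  · rintro ⟨r, ⟨h0, h1⟩, q, hq, hqa⟩
    refine ⟨fun i => e.symm (r i), ⟨?_, fun i => ?_⟩, e.symm q, ?_, ?_⟩
    · simp [h0, relabel]
    · have h := h1 i
      simp only [relabel, Option.map_eq_some_iff] at h
      obtain ⟨a, ha, ha'⟩ := h
      simp [ha, ← ha']
    · simpa [infStates] using hq
    · simpa [relabel, Equiv.symm_apply_eq] using hqa
  · rintro ⟨r, ⟨h0, h1⟩, q, hq, hqa⟩
    refine ⟨fun i => e (r i), ⟨?_, fun i => ?_⟩, e q, ?_, ?_⟩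
    · simp [h0, relabel]
    · simp [relabel, h1 i]
    · simpa [infStates] using hq
    · simpa [relabel] using hqa

end DBW

/-! ### Automata that watch one cell of a tape -/

/-- What an automaton concludes from a letter: it gets stuck, it accepts, or it moves (by
`δ - 1`) and changes its record. -/
inductive Verdict (E : Type)
  | die : Verdict E
  | win : Verdict E
  | go (δ : Fin 3) (e : E) : Verdict E

/-- The states of an automaton that watches one of `S` cells: a position relative to the cell
(shifted by `S + 1`) and a record, or the accepting sink, or the number of a cell that may still
be chosen. -/
abbrev Watch (S : ℕ) (E : Type) : Type := (Fin (2 * S + 3) × E ⊕ Fin 1) ⊕ Fin S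

namespace Watch

variable {S : ℕ} {E A : Type}

abbrev sink : Watch S E := .inl (.inr 0)

/-- The state reached from position `d`. -/
def place (d : ℕ) : Verdict E → Option (Watch S E)
  | .die => none
  | .win => some sink
  | .go δ e => some (.inl (.inl (Fin.ofNat _ (d + δ - 1), e)))

/-- The transitions. The second component of a letter tells whether to choose the cell that is on
offer. -/
def next (respond : Bool → E → A → Verdict E) (ini : ℕ → E) :
    Watch S E → A × Bool → Option (Watch S E)
  | .inl (.inl (d, e)), (a, _) =>
    -- Since the border positions get stuck, `place` is only used with `1 ≤ d ≤ 2 * S + 1`, where `d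
    -- + δ - 1` neither truncates nor wraps around.
    if d.val = 0 ∨ d.val = 2 * S + 2 then none
    else place d (respond (decide (d.val = S + 1)) e a)
  | .inl (.inr _), _ => some sink
  | .inr i, (a, true) => place (S + 1) (respond true (ini i) a)
  -- Declining the last offer is fatal, which yields the rejected word that hiding demands.
  | .inr ⟨0, _⟩, (_, false) => none
  | .inr ⟨i + 1, h⟩, (_, false) => some (.inr ⟨i, by omega⟩)

/-- The automaton first offers the cells `S - 1, …, 0`; the record `ini i` is what it knows when it
chooses cell `i`. -/
def automaton (respond : Bool → E → A → Verdict E) (ini : ℕ → E) (hS : 0 < S) :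
    DBW (A × Bool) (Watch S E) where
  start := .inr ⟨S - 1, by omega⟩
  next := next respond ini
  accept := {sink}

variable {respond : Bool → E → A → Verdict E} {ini : ℕ → E} {hS : 0 < S}

theorem runTo_of_forall_not_choose {w : ℕ → A × Bool} {t : ℕ} (ht : t < S)
    (hw : ∀ s < t, (w s).2 = false) :
    (automaton respond ini hS).runTo w t = some (.inr ⟨S - 1 - t, by omega⟩) := by
  induction t with
  | zero => rfl
  | succ t ih =>
    rw [DBW.runTo, ih (by omega) fun s hs => hw s (by omega), Option.bind_some]
    have h0 : w t = ((w t).1, false) := by rw [← hw t (by omega)]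
    have h1 : S - 1 - t = (S - 1 - (t + 1)) + 1 := by omega
    have h2 : (⟨S - 1 - t, by omega⟩ : Fin S) = ⟨(S - 1 - (t + 1)) + 1, by omega⟩ := Fin.ext h1
    rw [h0, h2]
    rfl

theorem notMem_language_of_forall_not_choose {w : ℕ → A × Bool} (hw : ∀ s < S, (w s).2 = false) :
    w ∉ (automaton respond ini hS).language := by
  refine DBW.notMem_language_of_runTo_eq_none (n := S - 1 + 1) ?_
  rw [DBW.runTo, runTo_of_forall_not_choose (by omega) fun s hs => hw s (by omega),
    Option.bind_some]
  have h0 : w (S - 1) = ((w (S - 1)).1, false) := by rw [← hw (S - 1) (by omega)]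
  have h2 : (⟨S - 1 - (S - 1), by omega⟩ : Fin S) = ⟨0, by omega⟩ := Fin.ext (by simp)
  rw [h0, h2]
  rfl

end Watch

/-! ### Watching a Turing machine -/

namespace TapeMachine

variable (M : TapeMachine)

open Classical in
/-- The reaction of the machine to the symbol `a.1` under its head, where `a.2` tells whether the
head is on the leftmost cell: the new state, the symbol to write, and the move (shifted by `1`).
The machine is preceded by a phase with state `none`, in which it walks to the leftmost cell. -/
noncomputable def react (q : Option M.Q) (a : M.Γ × Bool) : Option (Option M.Q × M.Γ × Fin 3) :=
  match q with
  | none => some (if a.2 then (some M.start, a.1, 1) else (none, a.1, 0))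
  | some q => (M.next q a.1).map fun t =>
      (some t.1, t.2.1, match t.2.2 with
        -- A watcher knows only a relative position, so whether a left move is blocked has to come
        -- from the claim.
        | Dir.left => if a.2 then 1 else 0
        | Dir.right => 2)

/-- The content of the watched cell, with a mark if it is the leftmost one, and the state of the
machine. -/
abbrev Record : Type := (M.Γ × Bool) × Option M.Q

open Classical in
/-- The conclusion from the claim that the scanned cell contains `a`, where `here` tells whether
this is the watched cell. -/
noncomputable def respond (here : Bool) (e : M.Record) (a : M.Γ × Bool) : Verdict M.Record :=
  -- The comparison includes the mark, so a false claim about being leftmost is caught as well.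
  if here = true ∧ a ≠ e.1 then .win
  else match M.react e.2 a with
    | none => if ∃ q ∈ e.2, q ∈ M.accept then .win else .die
    | some t => .go t.2.2 ((if here then t.2.1 else e.1.1, e.1.2), t.1)

/-- The record about cell `i` before the computation on `x`. -/
def ini (x : List Bool) (i : ℕ) : M.Record := (((M.init x).tape i, decide (i = 0)), none)

variable {M}

/-- The configuration after `t` steps; a halted machine stays where it is. -/
def cfgAt (M : TapeMachine) (x : List Bool) (t : ℕ) : M.Cfg :=
  (fun c => (M.step c).getD c)^[t] (M.init x)

theorem cfgAt_succ (x : List Bool) (t : ℕ) :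
    M.cfgAt x (t + 1) = (M.step (M.cfgAt x t)).getD (M.cfgAt x t) :=
  Function.iterate_succ_apply' _ _ _

theorem reaches_cfgAt (x : List Bool) (t : ℕ) :
    StateTransition.Reaches M.step (M.init x) (M.cfgAt x t) := by
  induction t with
  | zero => exact Relation.ReflTransGen.refl
  | succ t ih =>
    rw [cfgAt_succ]
    cases h : M.step (M.cfgAt x t) with
    | none => exact ih
    | some c => exact ih.tail h

theorem exists_cfgAt_eq {x : List Bool} {c : M.Cfg}
    (h : StateTransition.Reaches M.step (M.init x) c) : ∃ t, M.cfgAt x t = c := by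
  induction h with
  | refl => exact ⟨0, rfl⟩
  | @tail b c _ hbc ih =>
    obtain ⟨t, rfl⟩ := ih
    refine ⟨t + 1, ?_⟩
    rw [cfgAt_succ, Option.mem_def.1 hbc, Option.getD_some]

theorem cfgAt_eq_of_halted {x : List Bool} {t : ℕ} (h : M.step (M.cfgAt x t) = none) (s : ℕ) :
    M.cfgAt x (t + s) = M.cfgAt x t := by
  induction s with
  | zero => rfl
  | succ s ih => rw [← add_assoc, cfgAt_succ, ih, h, Option.getD_none]

/-- The halting time of a machine that decides a language, and what is true by then. -/
theorem DecidesInSpace.exists_halting_time {L : Language Bool} {s : ℕ → ℕ}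
    (h : M.DecidesInSpace L s) (x : List Bool) :
    ∃ T, M.step (M.cfgAt x T) = none ∧ (∀ t < T, M.step (M.cfgAt x t) = some (M.cfgAt x (t + 1))) ∧
      ((M.cfgAt x T).state ∈ M.accept ↔ x ∈ L) := by
  classical
  obtain ⟨c, hc, hn, hacc⟩ := (h x).2
  obtain ⟨n, rfl⟩ := exists_cfgAt_eq hc
  have hex : ∃ T, M.step (M.cfgAt x T) = none := ⟨n, hn⟩
  have hT := Nat.find_spec hex
  refine ⟨Nat.find hex, hT, fun t ht => ?_, ?_⟩
  · have := Nat.find_min hex ht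
    cases hs : M.step (M.cfgAt x t) with
    | none => exact absurd hs this
    | some c => rw [cfgAt_succ, hs, Option.getD_some]
  · obtain ⟨k, hk⟩ := Nat.exists_eq_add_of_le (Nat.find_min' hex hn)
    rw [← hacc, hk, cfgAt_eq_of_halted hT]

/-- State, head position and tape at time `t`, when the computation is preceded by a walk of the
head from cell `S - 1` to cell `0`. -/
def walkAt (M : TapeMachine) (S : ℕ) (x : List Bool) (t : ℕ) : Option M.Q × ℕ × (ℕ → M.Γ) :=
  if t < S then (none, S - 1 - t, (M.init x).tape)
  else (some (M.cfgAt x (t - S)).state, (M.cfgAt x (t - S)).head, (M.cfgAt x (t - S)).tape)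

/-- The scanned symbol at time `t`, with a mark on the leftmost cell. -/
def scanAt (M : TapeMachine) (S : ℕ) (x : List Bool) (t : ℕ) : M.Γ × Bool :=
  ((M.walkAt S x t).2.2 (M.walkAt S x t).2.1, decide ((M.walkAt S x t).2.1 = 0))

/-- There are three kinds of step: inside the walk, the last step of the walk (in place, on cell 0),
and a step of the machine. The `+ 1` in the equation for the head offsets the shift of `δ`. -/
theorem react_scanAt {S : ℕ} (hS : 0 < S) {x : List Bool} {T : ℕ}
    (hT : ∀ t < T, M.step (M.cfgAt x t) = some (M.cfgAt x (t + 1))) {t : ℕ} (ht : t < S + T) :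
    ∃ g : M.Γ, ∃ δ : Fin 3,
      M.react (M.walkAt S x t).1 (M.scanAt S x t) = some ((M.walkAt S x (t + 1)).1, g, δ) ∧
      (M.walkAt S x (t + 1)).2.1 + 1 = (M.walkAt S x t).2.1 + δ ∧
      (M.walkAt S x (t + 1)).2.2 =
        Function.update (M.walkAt S x t).2.2 (M.walkAt S x t).2.1 g := by
  by_cases h1 : t + 1 < S
  · have h2 : t < S := by omega
    have h3 : S - 1 - t ≠ 0 := by omega
    refine ⟨(M.init x).tape (S - 1 - t), 0, ?_, ?_, ?_⟩
    · simp [react, scanAt, walkAt, h1, h2, h3]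
    · simp only [walkAt, h1, h2, if_true]
      simp
      omega
    · simp [walkAt, h1, h2]
  · by_cases h2 : t < S
    · obtain rfl : S = t + 1 := by omega
      refine ⟨(M.init x).tape 0, 1, ?_, ?_, ?_⟩
      · simp [react, scanAt, walkAt, cfgAt, init]
      · simp [walkAt, cfgAt, init]
      · simp [walkAt, cfgAt]
    · obtain ⟨s, rfl⟩ := Nat.exists_eq_add_of_le (not_lt.1 h2)
      have hs := hT s (by omega)
      have h3 : ¬ S + s + 1 < S := by omega
      have h4 : S + s + 1 - S = s + 1 := by omega
      have h5 : S + s - S = s := by omega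
      simp only [walkAt, scanAt, h2, h3, h4, h5, if_false]
      generalize M.cfgAt x (s + 1) = c' at hs ⊢
      generalize M.cfgAt x s = c at hs ⊢
      simp only [step, Option.map_eq_some_iff] at hs
      obtain ⟨⟨q, g, d⟩, hn, rfl⟩ := hs
      simp only [react, hn]
      refine ⟨g, _, rfl, ?_, rfl⟩
      cases d
      · by_cases h0 : c.head = 0
        · simp [move, h0]
        · simp [move, h0]; omega
      · simp [move]

theorem react_scanAt_of_halted {S : ℕ} {x : List Bool} {T : ℕ}
    (hT : M.step (M.cfgAt x T) = none) :
    M.react (M.walkAt S x (S + T)).1 (M.scanAt S x (S + T)) = none := by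
  simp only [step, Option.map_eq_none_iff] at hT
  simp [walkAt, scanAt, react, hT]

theorem walkAt_head_lt {L : Language Bool} {s : ℕ → ℕ} (h : M.DecidesInSpace L s)
    {x : List Bool} {S : ℕ} (hs : s x.length ≤ S) (t : ℕ) :
    (M.walkAt S x t).2.1 < S := by
  by_cases ht : t < S
  · simp [walkAt, ht]; omega
  · simp only [walkAt, ht, if_false]
    exact ((h x).1 _ (reaches_cfgAt x _)).trans_le hs

/-- The automaton whose language contains the words of claims that do not describe a rejecting
computation on `x`, provided that the right cell is chosen. -/
noncomputable def watcher (M : TapeMachine) (x : List Bool) {S : ℕ} (hS : 0 < S) :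
    DBW ((M.Γ × Bool) × Bool) (Watch S M.Record) :=
  Watch.automaton M.respond (M.ini x) hS

/-- The state of the automaton that has chosen cell `j`, when all claims up to time `t` are
true. -/
def watchAt (M : TapeMachine) (S : ℕ) (x : List Bool) (j t : ℕ) : Watch S M.Record :=
  .inl (.inl (Fin.ofNat _ (S + 1 + (M.walkAt S x t).2.1 - j),
    (((M.walkAt S x t).2.2 j, decide (j = 0)), (M.walkAt S x t).1)))

/-! ### The true computation as seen from one cell -/

section

variable {S : ℕ} {hS : 0 < S} {x : List Bool} {j t : ℕ}

theorem next_watchAt (hj : j < S) (ht : (M.walkAt S x t).2.1 < S) (a : M.Γ × Bool) (b : Bool) :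
    (M.watcher x hS).next (M.watchAt S x j t) (a, b) =
      Watch.place (S + 1 + (M.walkAt S x t).2.1 - j)
        (M.respond (decide ((M.walkAt S x t).2.1 = j))
          (((M.walkAt S x t).2.2 j, decide (j = 0)), (M.walkAt S x t).1) a) := by
  have h : (S + 1 + (M.walkAt S x t).2.1 - j) % (2 * S + 3) = S + 1 + (M.walkAt S x t).2.1 - j :=
    Nat.mod_eq_of_lt (by omega)
  have h1 : ¬ (S + 1 + (M.walkAt S x t).2.1 - j = 0 ∨
      S + 1 + (M.walkAt S x t).2.1 - j = 2 * S + 2) := by omega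
  have h2 : (S + 1 + (M.walkAt S x t).2.1 - j = S + 1) ↔ (M.walkAt S x t).2.1 = j := by omega
  simp only [watcher, Watch.automaton, watchAt, Watch.next, Fin.val_ofNat, h, h1, h2, if_false]

/-- At time `S - 1 - j` the walking head stands on cell `j`, so choosing `j` has the same effect as
having watched it from the beginning. -/
theorem next_choose (hj : j < S) (a : M.Γ × Bool) (b : Bool) :
    (M.watcher x hS).next (.inr ⟨j, hj⟩) (a, true) =
      (M.watcher x hS).next (M.watchAt S x j (S - 1 - j)) (a, b) := by
  have h1 : M.walkAt S x (S - 1 - j) = (none, j, (M.init x).tape) := by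
    rw [walkAt, if_pos (by omega)]
    congr 2
    omega
  rw [next_watchAt hj (by rw [h1]; exact hj), h1]
  simp [watcher, Watch.automaton, Watch.next, ini]

/-- A true claim cannot trigger a win, the relative position moves along with the head, and the
watched content changes only when its cell is scanned. -/
theorem next_watchAt_scanAt {T : ℕ}
    (hT : ∀ t < T, M.step (M.cfgAt x t) = some (M.cfgAt x (t + 1)))
    (hh : ∀ t, (M.walkAt S x t).2.1 < S) (hj : j < S) (ht : t < S + T) (b : Bool) :
    (M.watcher x hS).next (M.watchAt S x j t) (M.scanAt S x t, b) =
      some (M.watchAt S x j (t + 1)) := by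
  rw [next_watchAt hj (hh t)]
  obtain ⟨g, δ, h1, h2, h3⟩ := react_scanAt hS hT ht
  have h4 : ¬ (decide ((M.walkAt S x t).2.1 = j) = true ∧
      M.scanAt S x t ≠ ((M.walkAt S x t).2.2 j, decide (j = 0))) := by
    simp only [decide_eq_true_eq]
    rintro ⟨rfl, h⟩
    exact h rfl
  have h5 : S + 1 + (M.walkAt S x t).2.1 - j + δ - 1 =
      S + 1 + (M.walkAt S x (t + 1)).2.1 - j := by omega
  simp only [respond, h4, if_false, h1, Watch.place, h5, watchAt, h3]
  by_cases hje : (M.walkAt S x t).2.1 = j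
  · subst hje
    simp
  · simp [hje, Function.update_of_ne (Ne.symm hje)]

theorem next_watchAt_of_ne (hj : (M.walkAt S x t).2.1 < S) {a : M.Γ × Bool}
    (ha : a ≠ M.scanAt S x t) (b : Bool) :
    (M.watcher x hS).next (M.watchAt S x (M.walkAt S x t).2.1 t) (a, b) = some Watch.sink := by
  rw [next_watchAt hj hj, respond, if_pos ⟨by simp, ha⟩]
  rfl

open Classical in
theorem next_watchAt_of_halted {T : ℕ} (hT : M.step (M.cfgAt x T) = none)
    (hh : ∀ t, (M.walkAt S x t).2.1 < S) (hj : j < S) (b : Bool) :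
    (M.watcher x hS).next (M.watchAt S x j (S + T)) (M.scanAt S x (S + T), b) =
      if (M.cfgAt x T).state ∈ M.accept then some Watch.sink else none := by
  rw [next_watchAt hj (hh _)]
  have h4 : ¬ (decide ((M.walkAt S x (S + T)).2.1 = j) = true ∧
      M.scanAt S x (S + T) ≠ ((M.walkAt S x (S + T)).2.2 j, decide (j = 0))) := by
    simp only [decide_eq_true_eq]
    rintro ⟨rfl, h⟩
    exact h rfl
  have h5 : (M.walkAt S x (S + T)).1 = some (M.cfgAt x T).state := by simp [walkAt]
  have h6 := react_scanAt_of_halted (S := S) hT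
  rw [h5] at h6
  simp only [respond, h4, if_false, h5, h6]
  by_cases hacc : (M.cfgAt x T).state ∈ M.accept <;> simp [hacc, Watch.place]

/-- As long as all claims are true, the automaton follows the computation. -/
theorem runTo_watcher {T : ℕ}
    (hT : ∀ t < T, M.step (M.cfgAt x t) = some (M.cfgAt x (t + 1)))
    (hh : ∀ t, (M.walkAt S x t).2.1 < S) (hj : j < S) {w : ℕ → (M.Γ × Bool) × Bool}
    (hw0 : ∀ s < S - 1 - j, (w s).2 = false) (hw1 : (w (S - 1 - j)).2 = true)
    (hjt : S - 1 - j ≤ t) (ht : t ≤ S + T) (hw : ∀ s < t, (w s).1 = M.scanAt S x s) :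
    (M.watcher x hS).runTo w (t + 1) = (M.watcher x hS).next (M.watchAt S x j t) (w t) := by
  -- The statement speaks of the state after letter `t` because at time `S - 1 - j` the automaton is
  -- still choosing and only moves as a watcher would. The claim in letter `t` need not be true.
  induction t, hjt using Nat.le_induction with
  | base =>
    rw [DBW.runTo, watcher, Watch.runTo_of_forall_not_choose (by omega) hw0, Option.bind_some]
    have h0 : w (S - 1 - j) = ((w (S - 1 - j)).1, true) := by rw [← hw1]
    have h1 : (⟨S - 1 - (S - 1 - j), by omega⟩ : Fin S) = ⟨j, hj⟩ := Fin.ext (by simp; omega)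
    rw [h0, h1]
    exact next_choose hj _ true
  | succ t hjt ih =>
    rw [DBW.runTo, ih (by omega) fun s hs => hw s (by omega)]
    have h0 : w t = (M.scanAt S x t, (w t).2) := by rw [← hw t (by omega)]
    rw [h0, next_watchAt_scanAt hT hh hj (by omega), Option.bind_some]

end

/-! ### Members and non-members of the language -/

variable {L : Language Bool} {s : ℕ → ℕ}

/-- If `x` is in the language, then every word of claims is accepted for some choice. -/
theorem DecidesInSpace.exists_choice (h : M.DecidesInSpace L s) {x : List Bool} {S : ℕ}
    (hs : s x.length ≤ S) (hS : 0 < S) (hx : x ∈ L) (a : ℕ → M.Γ × Bool) :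
    ∃ c : ℕ → Bool, (fun i => (a i, c i)) ∈ (M.watcher x hS).language := by
  classical
  obtain ⟨T, hT, hlt, hacc⟩ := h.exists_halting_time x
  have hh := walkAt_head_lt h hs
  -- The decisive time is that of the first false claim, or the halting time if no false claim comes
  -- before it.
  have hex : ∃ t, a t ≠ M.scanAt S x t ∨ t = S + T := ⟨S + T, .inr rfl⟩
  set t := Nat.find hex with ht
  have htle : t ≤ S + T := Nat.find_min' hex (.inr rfl)
  have hmin : ∀ s < t, a s = M.scanAt S x s := fun s hs => by
    have := Nat.find_min hex hs
    tauto
  set j := (M.walkAt S x t).2.1 with hj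
  -- The cell scanned at the decisive time can still be chosen: during the walk it is on offer at
  -- that very moment, and after the walk its offer lies in the past.
  have hjt : S - 1 - j ≤ t := by
    by_cases h1 : t < S
    · simp [hj, walkAt, h1]; omega
    · omega
  refine ⟨fun i => decide (i = S - 1 - j),
    DBW.mem_language_of_runTo_eq_sink (n := t + 1) (q := Watch.sink) ?_ ?_ fun _ => rfl⟩
  · rw [runTo_watcher hlt hh (j := j) (hh t) (fun s hs => by simpa using hs.ne) (by simp) hjt htle
      hmin]
    by_cases hne : a t ≠ M.scanAt S x t
    · exact next_watchAt_of_ne (hh t) hne _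
    · have hte : t = S + T := (Nat.find_spec hex).resolve_left hne
      rw [not_not.1 hne, hte, next_watchAt_of_halted hT hh (hh t), if_pos (hacc.2 hx)]
  · exact Finset.mem_singleton_self _

/-- If `x` is not in the language, then some word of claims is rejected for all choices. -/
theorem DecidesInSpace.exists_forall_choice (h : M.DecidesInSpace L s) {x : List Bool} {S : ℕ}
    (hs : s x.length ≤ S) (hS : 0 < S) (hx : x ∉ L) :
    ∃ a : ℕ → M.Γ × Bool, ∀ c : ℕ → Bool,
      (fun i => (a i, c i)) ∉ (M.watcher x hS).language := by
  classical
  obtain ⟨T, hT, hlt, hacc⟩ := h.exists_halting_time x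
  have hh := walkAt_head_lt h hs
  refine ⟨M.scanAt S x, fun c => ?_⟩
  -- Only the first choice counts. Made at time `i`, it selects cell `S - 1 - i`, whose watcher sees
  -- true claims until the machine halts and rejects.
  by_cases hc : ∃ i, i < S ∧ c i = true
  · set i := Nat.find hc with hi
    obtain ⟨hiS, hic⟩ := Nat.find_spec hc
    have he : S - 1 - (S - 1 - i) = i := by omega
    refine DBW.notMem_language_of_runTo_eq_none (n := S + T + 1) ?_
    rw [runTo_watcher hlt hh (j := S - 1 - i) (by omega) (fun s hs => ?_) (by rw [he]; exact hic)
      (by omega) le_rfl (fun _ _ => rfl), next_watchAt_of_halted hT hh (by omega),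
      if_neg fun h => hx (hacc.1 h)]
    have := Nat.find_min hc (m := s) (by omega)
    simpa using fun hcs => this ⟨by omega, hcs⟩
  · refine Watch.notMem_language_of_forall_not_choose fun i hi => ?_
    simpa using fun hci => hc ⟨i, hi, hci⟩

end TapeMachine

/-! ### The reduction -/

namespace TapeMachine

attribute [instance] TapeMachine.finQ TapeMachine.finΓ

variable (M : TapeMachine)

/-- The number of visible signals. -/
noncomputable def numBits : ℕ := Fintype.card (M.Γ × Bool)

/-- The number of records. -/
noncomputable def numRecords : ℕ := Fintype.card M.Record

noncomputable def recordEquiv : M.Record ≃ Fin M.numRecords := Fintype.equivFin _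

/-- One bit per claim is more than enough because `n < 2 ^ n`. Surjectivity makes every word of
claims available as an input word. -/
theorem exists_decode : ∃ f : Assignment (Fin M.numBits) → M.Γ × Bool, Function.Surjective f := by
  classical
  have : Nonempty (M.Γ × Bool) := ⟨(M.blank, true)⟩
  have hcard : Fintype.card (M.Γ × Bool) ≤ Fintype.card (Fin M.numBits → Bool) := by
    simpa [numBits] using (Nat.lt_two_pow_self (n := M.numBits)).le
  obtain ⟨f⟩ := Function.Embedding.nonempty_of_card_le hcard
  exact ⟨Function.invFun f, Function.invFun_surjective f.injective⟩

/-- The claimed symbol that an assignment to the visible signals stands for. -/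
noncomputable def decode : Assignment (Fin M.numBits) → M.Γ × Bool := M.exists_decode.choose

theorem decode_surjective : Function.Surjective M.decode := M.exists_decode.choose_spec

/-- The visible signals make a claim, and the hidden signal tells whether to choose a cell. -/
noncomputable def readLetter (l : Assignment (Fin M.numBits ⊕ Fin 1)) : (M.Γ × Bool) × Bool :=
  (M.decode fun i => l (.inl i), l (.inr 0))

/-- The number of states of the automaton. -/
noncomputable def numWatch (S : ℕ) : ℕ := (2 * S + 3) * M.numRecords + 1 + S

noncomputable def watchEquiv (S : ℕ) : Watch S M.Record ≃ Fin (M.numWatch S) :=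
  (Equiv.sumCongr ((Equiv.sumCongr ((Equiv.prodCongr (Equiv.refl _) M.recordEquiv).trans
    finProdFinEquiv) (Equiv.refl _)).trans finSumFinEquiv) (Equiv.refl _)).trans finSumFinEquiv

/-- The instance for the input `x`, when `S` is a bound on the space that the machine uses. -/
noncomputable def hidingInput (x : List Bool) {S : ℕ} (hS : 0 < S) : HidingInput where
  numIn := M.numBits
  numOut := 1
  numStates := M.numWatch S
  secret := (M.watcher x hS).relabel M.readLetter (M.watchEquiv S)
  hidden := {.inr 0}
  bound := 1
  one_le_bound := le_rfl

variable {M}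

/-- Noise on the single hidden output ranges over all choices for the given claims, whatever the
transducer does. Only the accepted word is needed to derive membership; conversely, the rejected
word is the one that never chooses. -/
theorem DecidesInSpace.holds_hidingInput_iff {L : Language Bool} {s : ℕ → ℕ}
    (h : M.DecidesInSpace L s) {x : List Bool} {S : ℕ} (hs : s x.length ≤ S) (hS : 0 < S) :
    (M.hidingInput x hS).Holds ↔ x ∈ L := by
  constructor
  · rintro ⟨Q, _, T, -, hT⟩
    by_contra hx
    obtain ⟨a, ha⟩ := h.exists_forall_choice hs hS hx
    choose w hw using fun i => M.decode_surjective (a i)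
    obtain ⟨w', hw', hl⟩ := (hT w).1
    replace hl := (DBW.mem_language_relabel (M.watcher x hS) M.readLetter (M.watchEquiv S) w').1 hl
    refine ha (fun i => w' i (.inr (0 : Fin 1))) ?_
    convert! hl using 2 with i
    simp only [readLetter]
    congr 1
    rw [← hw i]
    congr 1
    funext p
    exact (hw' i (.inl p) fun hp => Sum.inl_ne_inr (Finset.mem_singleton.1 hp)).symm
  · intro hx
    refine ⟨Unit, inferInstance, ⟨(), fun _ _ => (), fun _ _ => false⟩, le_rfl, fun w => ?_⟩
    have key : ∀ (c : ℕ → Bool), ∃ w' ∈ noise ((M.hidingInput x hS).hidden : Set _)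
        (Transducer.computation ⟨(), fun _ _ => (), fun _ _ => false⟩ w),
        (w' ∈ (M.hidingInput x hS).secret.language ↔
          (fun i => (M.decode (w i), c i)) ∈ (M.watcher x hS).language) := by
      intro c
      refine ⟨fun i => Sum.elim (w i) fun _ => c i, ?_, DBW.mem_language_relabel _ _ _ _⟩
      rintro j (p | p) hp
      · rfl
      · refine absurd ?_ hp
        exact Finset.mem_coe.2 (Finset.mem_singleton.2
          (congrArg Sum.inr (Subsingleton.elim (α := Fin 1) _ _)))
    obtain ⟨c, hc⟩ := h.exists_choice hs hS hx fun i => M.decode (w i)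
    obtain ⟨w₁, hw₁, h₁⟩ := key c
    obtain ⟨w₂, hw₂, h₂⟩ := key fun _ => false
    exact ⟨⟨w₁, hw₁, h₁.2 hc⟩, w₂, hw₂, fun hl =>
      Watch.notMem_language_of_forall_not_choose (fun _ _ => rfl) (h₂.1 hl)⟩

end TapeMachine

/-! ### The representation of the instance -/

theorem List.flatMap_finRange_add {α : Type} (a b : ℕ) (f : Fin (a + b) → List α) :
    (List.finRange (a + b)).flatMap f =
      (List.finRange a).flatMap (fun i => f (Fin.castAdd b i)) ++
        (List.finRange b).flatMap (fun i => f (Fin.natAdd a i)) := by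
  simp only [List.flatMap, ← List.ofFn_eq_map, List.ofFn_add, List.flatten_append]
  rfl

theorem List.flatMap_finRange_mul {α : Type} (a b : ℕ) (f : Fin (a * b) → List α) :
    (List.finRange (a * b)).flatMap f =
      (List.finRange a).flatMap (fun i => (List.finRange b).flatMap fun j =>
        f (finProdFinEquiv (i, j))) := by
  simp only [List.flatMap, ← List.ofFn_eq_map, List.ofFn_mul, List.flatten_flatten, List.map_ofFn]
  congr 2
  funext i
  simp only [Function.comp_def]
  congr 2
  funext j
  congr 1
  ext
  simp [finProdFinEquiv]
  ring

theorem List.flatMap_finRange_val {α : Type} (n : ℕ) (f : ℕ → List α) :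
    (List.finRange n).flatMap (fun i : Fin n => f i) = (List.range n).flatMap f := by
  rw [← List.map_coe_finRange_eq_range, List.flatMap_map]

theorem List.flatMap_product {α β γ : Type} (l : List α) (l' : List β) (f : α × β → List γ) :
    (l ×ˢ l').flatMap f = l.flatMap fun a => l'.flatMap fun b => f (a, b) := by
  induction l with
  | nil => simp
  | cons a l ih => simp [List.product_cons, ih, List.flatMap_map]

/-- The unary code of an affine expression in `s` and `d`. -/
def affineCode (s d : ℕ) (c : ℕ × ℕ × ℕ) : List Bool := unary (c.1 * s + c.2.1 * d + c.2.2)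

/-! ### The transition table as a list of affine codes -/

namespace TapeMachine

variable (M : TapeMachine)

/-- The coefficients of the code of a target state, as an affine expression in the space bound and
the number of the present block. -/
noncomputable def blockCoeffs : Verdict M.Record → ℕ × ℕ × ℕ
  | .die => (0, 0, 0)
  -- The sink has number `(2 * S + 3) * numRecords`, and `targetCode` adds one.
  | .win => (2 * M.numRecords, 0, 3 * M.numRecords + 1)
  -- Block number `d` belongs to position `d + 1`, so the move by `δ - 1` leads to position `d + δ`.
  | .go δ e => (0, M.numRecords, δ * M.numRecords + M.recordEquiv e + 1)

/-- The same for the central block. -/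
noncomputable def centerCoeffs : Verdict M.Record → ℕ × ℕ × ℕ
  | .die => (0, 0, 0)
  | .win => (2 * M.numRecords, 0, 3 * M.numRecords + 1)
  -- The central block has number `S`. It is expressed by the space bound because the counter holds
  -- the cell number when the rows of the choosable cells are written.
  | .go δ e => (M.numRecords, 0, δ * M.numRecords + M.recordEquiv e + 1)

/-- All letters, in the order of the table. -/
noncomputable def letters : List ((M.Γ × Bool) × Bool) :=
  (List.range (2 ^ (M.numBits + 1))).map fun k => M.readLetter (letter M.numBits 1 k)

noncomputable def padRows : List (ℕ × ℕ × ℕ) :=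
  (List.finRange M.numRecords).flatMap fun _ => M.letters.map fun _ => (0, 0, 0)

noncomputable def blockRows (here : Bool) : List (ℕ × ℕ × ℕ) :=
  (List.finRange M.numRecords).flatMap fun e => M.letters.map fun l =>
    M.blockCoeffs (M.respond here (M.recordEquiv.symm e) l.1)

noncomputable def sinkRow : List (ℕ × ℕ × ℕ) :=
  M.letters.map fun _ => (2 * M.numRecords, 0, 3 * M.numRecords + 1)

/-- The row of a cell that may be chosen, with initial content `o`. -/
noncomputable def walkRow (o : Option Bool) (leftmost : Bool) : List (ℕ × ℕ × ℕ) :=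
  M.letters.map fun l =>
    if l.2 then M.centerCoeffs (M.respond true ((o.elim M.blank M.sym, leftmost), none) l.1)
    -- Declining cell `i > 0` leads to the state with number `(2 * S + 3) * numRecords + 1 + (i -
    -- 1)`.
    else if leftmost then (0, 0, 0) else (2 * M.numRecords, 1, 3 * M.numRecords + 1)

/-- The table of the transition function. -/
noncomputable def tableCode (S : ℕ) (x : List Bool) : List Bool :=
  M.padRows.flatMap (affineCode S 0) ++
  ((List.range S).flatMap (fun d => (M.blockRows false).flatMap (affineCode S d)) ++
  ((M.blockRows true).flatMap (affineCode S S) ++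
  ((List.range S).flatMap (fun d => (M.blockRows false).flatMap (affineCode S (S + 1 + d))) ++
  (M.padRows.flatMap (affineCode S 0) ++
  (M.sinkRow.flatMap (affineCode S 0) ++
  (List.range S).flatMap (fun i => (M.walkRow x[i]? (decide (i = 0))).flatMap (affineCode S i)))))))

variable {M}

theorem val_watchEquiv_watch (S : ℕ) (d : Fin (2 * S + 3)) (e : M.Record) :
    (M.watchEquiv S (.inl (.inl (d, e)))).val = M.recordEquiv e + M.numRecords * d := rfl

theorem val_watchEquiv_sink (S : ℕ) :
    (M.watchEquiv S Watch.sink).val = (2 * S + 3) * M.numRecords := rfl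

theorem val_watchEquiv_walk (S : ℕ) (i : Fin S) :
    (M.watchEquiv S (.inr i)).val = (2 * S + 3) * M.numRecords + 1 + i := rfl

theorem flatMap_finRange_numWatch (S : ℕ) (f : Fin (M.numWatch S) → List Bool) :
    (List.finRange (M.numWatch S)).flatMap f =
      (List.finRange (2 * S + 3)).flatMap (fun d => (List.finRange M.numRecords).flatMap fun e =>
        f (M.watchEquiv S (.inl (.inl (d, M.recordEquiv.symm e))))) ++
      (f (M.watchEquiv S Watch.sink) ++
        (List.finRange S).flatMap fun i => f (M.watchEquiv S (.inr i))) := by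
  unfold numWatch at f ⊢
  rw [List.flatMap_finRange_add, List.flatMap_finRange_add, List.flatMap_finRange_mul,
    List.append_assoc]
  congr 1
  · congr 1
    funext d
    congr 1
    funext e
    congr 1
    ext
    refine Eq.trans ?_ (val_watchEquiv_watch (M := M) S d _).symm
    simp
  · congr 1
    exact List.append_nil _

theorem targetCode_map_place {S d : ℕ} (h1 : 1 ≤ d) (h2 : d ≤ 2 * S + 1) (v : Verdict M.Record) :
    unary (targetCode ((Watch.place d v).map (M.watchEquiv S))) =
      affineCode S (d - 1) (M.blockCoeffs v) := by
  cases v with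
  | die => simp [Watch.place, targetCode, affineCode, blockCoeffs]
  | win =>
    simp only [Watch.place, Option.map_some, targetCode, val_watchEquiv_sink, affineCode,
      blockCoeffs]
    congr 1
    ring
  | go δ e =>
    have h3 : (d + (δ : ℕ) - 1) % (2 * S + 3) = d - 1 + δ := by
      rw [Nat.mod_eq_of_lt (by omega)]
      omega
    simp only [Watch.place, Option.map_some, targetCode, val_watchEquiv_watch, Fin.val_ofNat, h3,
      affineCode, blockCoeffs]
    congr 1
    ring

theorem affineCode_centerCoeffs (S d : ℕ) (v : Verdict M.Record) :
    affineCode S d (M.centerCoeffs v) = affineCode S S (M.blockCoeffs v) := by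
  cases v <;> simp [affineCode, centerCoeffs, blockCoeffs]

theorem table_hidingInput (x : List Bool) {S : ℕ} (hS : 0 < S) :
    (List.finRange (M.numWatch S) ×ˢ List.range (2 ^ (M.numBits + 1))).flatMap
      (fun qk => unary (targetCode ((M.hidingInput x hS).secret.next qk.1
        (letter M.numBits 1 qk.2)))) = M.tableCode S x := by
  have hrow : ∀ q : Watch S M.Record,
      ((List.range (2 ^ (M.numBits + 1))).flatMap fun k =>
        unary (targetCode ((M.hidingInput x hS).secret.next (M.watchEquiv S q)
          (letter M.numBits 1 k)))) =
      M.letters.flatMap fun l =>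
        unary (targetCode (((M.watcher x hS).next q l).map (M.watchEquiv S))) := by
    intro q
    simp [letters, List.flatMap_map, hidingInput, DBW.relabel]
  have hblock : ∀ d : Fin (2 * S + 3),
      ((List.finRange M.numRecords).flatMap fun e => M.letters.flatMap fun l =>
        unary (targetCode (((M.watcher x hS).next (.inl (.inl (d, M.recordEquiv.symm e))) l).map
          (M.watchEquiv S)))) =
      if d.val = 0 ∨ d.val = 2 * S + 2 then M.padRows.flatMap (affineCode S 0)
      else (M.blockRows (decide (d.val = S + 1))).flatMap (affineCode S (d - 1)) := by
    intro d
    split_ifs with hd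
    · simp only [padRows, List.flatMap_assoc, List.flatMap_map]
      simp only [watcher, Watch.automaton, Watch.next, hd, if_true]
      simp [targetCode, affineCode]
    · simp only [blockRows, List.flatMap_assoc, List.flatMap_map]
      simp only [watcher, Watch.automaton, Watch.next, hd, if_false]
      congr 1
      funext e
      congr 1
      funext l
      exact targetCode_map_place (by omega) (by omega) _
  have hsink : (M.letters.flatMap fun l =>
        unary (targetCode (((M.watcher x hS).next Watch.sink l).map (M.watchEquiv S)))) =
      M.sinkRow.flatMap (affineCode S 0) := by
    simp only [sinkRow, List.flatMap_map]
    congr 1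
    funext l
    exact targetCode_map_place (M := M) (d := 1) le_rfl (by omega) .win
  have hwalk : ∀ i : Fin S, (M.letters.flatMap fun l =>
        unary (targetCode (((M.watcher x hS).next (.inr i) l).map (M.watchEquiv S)))) =
      (M.walkRow x[i.val]? (decide (i.val = 0))).flatMap (affineCode S i) := by
    intro i
    simp only [walkRow, List.flatMap_map]
    congr 1
    funext ⟨a, b⟩
    cases b with
    | true =>
      simp only [watcher, Watch.automaton, Watch.next, if_true, affineCode_centerCoeffs]
      exact targetCode_map_place (by omega) (by omega) _
    | false =>
      obtain ⟨_ | i, hi⟩ := i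
      · simp [watcher, Watch.automaton, Watch.next, targetCode, affineCode]
      · simp only [watcher, Watch.automaton, Watch.next, Option.map_some, targetCode,
          val_watchEquiv_walk, affineCode]
        simp
        congr 1
        ring
  rw [List.flatMap_product, flatMap_finRange_numWatch]
  simp only [hrow, hblock, hsink, hwalk]
  rw [List.flatMap_finRange_val (2 * S + 3) fun d =>
      if d = 0 ∨ d = 2 * S + 2 then M.padRows.flatMap (affineCode S 0)
      else (M.blockRows (decide (d = S + 1))).flatMap (affineCode S (d - 1)),
    List.flatMap_finRange_val S fun i =>
      (M.walkRow x[i]? (decide (i = 0))).flatMap (affineCode S i),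
    -- The summands are the border, the positions left of the watched cell, that cell, the positions
    -- right of it, and the border.
    show 2 * S + 3 = 1 + (S + (1 + (S + 1))) by ring]
  simp only [List.range_add, List.flatMap_append, List.flatMap_map, List.append_assoc, tableCode,
    List.range_one, List.map_cons, List.map_nil, List.flatMap_cons, List.flatMap_nil,
    List.append_nil]
  have h1 : (List.range S).flatMap (fun d => if 1 + d = 0 ∨ 1 + d = 2 * S + 2 then
      M.padRows.flatMap (affineCode S 0)
      else (M.blockRows (decide (1 + d = S + 1))).flatMap (affineCode S (1 + d - 1))) =
      (List.range S).flatMap fun d => (M.blockRows false).flatMap (affineCode S d) := by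
    refine List.flatMap_congr fun d hd => ?_
    have := List.mem_range.1 hd
    rw [if_neg (by omega), decide_eq_false (by omega), Nat.add_sub_cancel_left]
  have h2 : (List.range S).flatMap (fun d => if 1 + (S + (1 + d)) = 0 ∨ 1 + (S + (1 + d)) = 2 * S + 2
      then M.padRows.flatMap (affineCode S 0)
      else (M.blockRows (decide (1 + (S + (1 + d)) = S + 1))).flatMap
        (affineCode S (1 + (S + (1 + d)) - 1))) =
      (List.range S).flatMap fun d => (M.blockRows false).flatMap (affineCode S (S + 1 + d)) := by
    refine List.flatMap_congr fun d hd => ?_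
    have := List.mem_range.1 hd
    rw [if_neg (by omega), decide_eq_false (by omega), Nat.add_sub_cancel_left, add_assoc]
  rw [h1, h2, if_pos (.inl trivial), if_neg (by omega), if_pos (by omega), decide_eq_true (by omega)]
  simp

/-- The sink is numbered after all watching states and before the `S` choosing ones. -/
theorem ofFn_mem_sink_accept (S : ℕ) :
    List.ofFn (fun q => decide (q ∈ ({Watch.sink} : Finset (Watch S M.Record)).map
      (M.watchEquiv S).toEmbedding)) =
      List.replicate (2 * M.numRecords * S + 3 * M.numRecords) false ++ (true ::
        List.replicate S false) := by
  rw [List.ofFn_eq_map, List.map_eq_flatMap, flatMap_finRange_numWatch]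
  simp [List.flatMap_def]
  ring

theorem encode_hidingInput (x : List Bool) {S : ℕ} (hS : 0 < S) :
    (M.hidingInput x hS).encode =
      unary M.numBits ++ (unary 1 ++ (affineCode S 0 (2 * M.numRecords + 1, 0, 3 * M.numRecords + 1) ++
      (affineCode S 0 (2 * M.numRecords + 1, 0, 3 * M.numRecords) ++
      (List.replicate (2 * M.numRecords * S + 3 * M.numRecords) false ++ (true ::
      (List.replicate S false ++
      (List.replicate M.numBits false ++ (true :: (unary 1 ++ M.tableCode S x))))))))) := by
  have hF : List.ofFn (fun q => decide (q ∈ (M.hidingInput x hS).secret.accept)) =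
      List.replicate (2 * M.numRecords * S + 3 * M.numRecords) false ++ (true ::
        List.replicate S false) := by
    rw [← ofFn_mem_sink_accept]
    rfl
  have hI : List.ofFn (fun i => decide (Sum.inl i ∈ (M.hidingInput x hS).hidden)) =
      List.replicate M.numBits false := by
    have : ∀ i, decide (Sum.inl i ∈ (M.hidingInput x hS).hidden) = false := fun i =>
      decide_eq_false fun hp => Sum.inl_ne_inr (Finset.mem_singleton.1 hp)
    simp only [this, List.ofFn_const]
    rfl
  have hO : List.ofFn (fun j => decide (Sum.inr j ∈ (M.hidingInput x hS).hidden)) = [true] := by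
    have : ∀ j, decide (Sum.inr j ∈ (M.hidingInput x hS).hidden) = true := fun j =>
      decide_eq_true (Finset.mem_singleton.2
        (congrArg Sum.inr (Subsingleton.elim (α := Fin 1) _ _)))
    simp only [this, List.ofFn_const]
    rfl
  have hn : unary (M.hidingInput x hS).numStates =
      affineCode S 0 (2 * M.numRecords + 1, 0, 3 * M.numRecords + 1) := by
    rw [affineCode]
    congr 1
    change M.numWatch S = _
    rw [numWatch]
    ring
  have hs : unary (M.hidingInput x hS).secret.start =
      affineCode S 0 (2 * M.numRecords + 1, 0, 3 * M.numRecords) := by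
    rw [affineCode]
    congr 1
    change (M.watchEquiv S (.inr ⟨S - 1, _⟩)).val = _
    rw [val_watchEquiv_walk]
    have : (2 * S + 3) * M.numRecords + 1 + (S - 1) = (2 * S + 3) * M.numRecords + S := by omega
    rw [this]
    ring
  rw [HidingInput.encode, hF, hI, hO, hn, hs, ← table_hidingInput x hS]
  simp only [List.append_assoc, List.cons_append, List.nil_append]
  rfl

end TapeMachine

/-! ### Programs that write unary codes -/

/-- The stacks: input, output, reversed output, space bound, block number, loop counter, scratch,
length of the input. -/
inductive Stack
  | inp | out | aux | sp | ctr | loop | tmp | len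
  deriving DecidableEq

instance : Fintype Stack :=
  ⟨{.inp, .out, .aux, .sp, .ctr, .loop, .tmp, .len}, fun k => by cases k <;> decide⟩

namespace Stack

/-- Stacks with given input and reversed output, and with unary numbers on the others. -/
def conf (i a : List Bool) (s d l t n : ℕ) : Stack → List Bool
  | inp => i
  | out => []
  | aux => a
  | sp => List.replicate s true
  | ctr => List.replicate d true
  | loop => List.replicate l true
  | tmp => List.replicate t true
  | len => List.replicate n true

variable (i a i' a' : List Bool) (s d l t n m : ℕ)

theorem update_inp : Function.update (conf i a s d l t n) inp i' = conf i' a s d l t n := by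
  funext k; cases k <;> rfl

theorem update_aux : Function.update (conf i a s d l t n) aux a' = conf i a' s d l t n := by
  funext k; cases k <;> rfl

theorem update_sp : Function.update (conf i a s d l t n) sp (List.replicate m true) =
    conf i a m d l t n := by
  funext k; cases k <;> rfl

theorem update_ctr : Function.update (conf i a s d l t n) ctr (List.replicate m true) =
    conf i a s m l t n := by
  funext k; cases k <;> rfl

theorem update_loop : Function.update (conf i a s d l t n) loop (List.replicate m true) =
    conf i a s d m t n := by
  funext k; cases k <;> rfl

theorem update_tmp : Function.update (conf i a s d l t n) tmp (List.replicate m true) =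
    conf i a s d l m n := by
  funext k; cases k <;> rfl

theorem update_len : Function.update (conf i a s d l t n) len (List.replicate m true) =
    conf i a s d l t m := by
  funext k; cases k <;> rfl

end Stack

namespace StackProg

section General

variable {K : Type} [DecidableEq K]

/-- Each step pushes at most one bit. Thus the time spent on writing the output also bounds the cost
of reversing it. -/
theorem Run.length_le {p : StackProg K} {s s' : K → List Bool} {t : ℕ} (h : p.Run s s' t) (k : K) :
    (s' k).length ≤ (s k).length + t := by
  induction h with
  | skip => omega
  | push j b s =>
    by_cases hj : k = j
    · subst hj; simp
    · simp [hj]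
  | seq _ _ ih ih' => omega
  | @popCase j f s s' t _ ih =>
    by_cases hj : k = j
    · subst hj; simp at ih; omega
    · simp [hj] at ih; omega
  | drain_nil => omega
  | @drain_cons j f s s' s'' b l t t' hs _ _ ih ih' =>
    by_cases hj : k = j
    · subst hj; simp [hs] at ih ⊢; omega
    · simp [hj] at ih; omega
  | mono _ _ ih => omega

theorem Run.push' {k : K} {b : Bool} {s s' : K → List Bool}
    (h : Function.update s k (b :: s k) = s') : (StackProg.push k b).Run s s' 1 :=
  h ▸ Run.push k b s

/-- A loop over a unary number. -/
theorem Run.drain_replicate {k : K} {f : Bool → StackProg K} (F : ℕ → K → List Bool) {N B : ℕ}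
    -- `F m` describes the stacks when `m` marks are left.
    (hF : ∀ m ≤ N, F m k = List.replicate m true)
    (h : ∀ m < N, (f true).Run (Function.update (F (m + 1)) k (List.replicate m true)) (F m) B) :
    (drain k f).Run (F N) (F 0) (N * (B + 1) + 1) := by
  induction N with
  | zero => exact (Run.drain_nil (hF 0 le_rfl)).mono (by omega)
  | succ N ih =>
    refine (Run.drain_cons (hF _ le_rfl) (h N (by omega))
      (ih (fun m hm => hF m (by omega)) fun m hm => h m (by omega))).mono ?_
    rw [Nat.succ_mul]
    omega

/-- `c` copies of a program. -/
def rep (c : ℕ) (p : StackProg K) : StackProg K :=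
  match c with
  | 0 => skip
  | c + 1 => seq (rep c p) p

theorem Run.rep {p : StackProg K} (F : ℕ → K → List Bool) {c B : ℕ}
    (h : ∀ m < c, p.Run (F m) (F (m + 1)) B) : (rep c p).Run (F 0) (F c) (c * B + 1) := by
  induction c with
  | zero => exact (Run.skip _).mono (by omega)
  | succ c ih =>
    refine ((ih fun m hm => h m (by omega)).seq (h c (by omega))).mono ?_
    rw [Nat.succ_mul]
    omega

end General

/-! ### Loops that write affine codes onto the reversed output -/

open Stack

variable {i a : List Bool} {s d l n : ℕ}

/-- Runs `p` once for every mark on stack `k`, and restores the stack. -/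
def forMarks (k : Stack) (p : StackProg Stack) : StackProg Stack :=
  seq (drain k fun _ => seq (push tmp true) p) (drain tmp fun _ => push k true)

/-- The marks travel to `tmp` and back. In between, the body meets changing contents of both stacks,
hence the arbitrary `r` and `t`. -/
theorem run_forMarks_sp {p : StackProg Stack} (I A : ℕ → List Bool) (l : ℕ → ℕ) {B : ℕ}
    (h : ∀ m < s, ∀ r t, p.Run (conf (I m) (A m) r d (l m) t n)
      (conf (I (m + 1)) (A (m + 1)) r d (l (m + 1)) t n) B) :
    (forMarks sp p).Run (conf (I 0) (A 0) s d (l 0) 0 n) (conf (I s) (A s) s d (l s) 0 n)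
      (s * (B + 4) + 2) := by
  have h1 := Run.drain_replicate (k := sp) (f := fun _ => seq (push tmp true) p) (B := 1 + B)
    (fun m => conf (I (s - m)) (A (s - m)) m d (l (s - m)) (s - m) n) (N := s)
    (fun m _ => rfl) (fun m hm => by
      simp only [update_sp]
      have e : s - m = s - (m + 1) + 1 := by omega
      rw [e]
      exact (Run.push' (update_tmp _ _ _ _ _ _ _ (s - (m + 1) + 1))).seq (h _ (by omega) _ _))
  have h2 := Run.drain_replicate (k := tmp) (f := fun _ => push sp true) (B := 1)
    (fun m => conf (I s) (A s) (s - m) d (l s) m n) (N := s)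
    (fun m _ => rfl) (fun m hm => by
      simp only [update_tmp]
      have e : s - m = s - (m + 1) + 1 := by omega
      rw [e]
      exact Run.push' (update_sp _ _ _ _ _ _ _ (s - (m + 1) + 1)))
  simp only [Nat.sub_self, Nat.sub_zero] at h1 h2
  refine (h1.seq h2).mono (le_of_eq ?_)
  ring

theorem run_forMarks_ctr {p : StackProg Stack} (A : ℕ → List Bool) {B : ℕ}
    (h : ∀ m < d, ∀ r t, p.Run (conf i (A m) s r l t n) (conf i (A (m + 1)) s r l t n) B) :
    (forMarks ctr p).Run (conf i (A 0) s d l 0 n) (conf i (A d) s d l 0 n) (d * (B + 4) + 2) := by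
  have h1 := Run.drain_replicate (k := ctr) (f := fun _ => seq (push tmp true) p) (B := 1 + B)
    (fun m => conf i (A (d - m)) s m l (d - m) n) (N := d)
    (fun m _ => rfl) (fun m hm => by
      simp only [update_ctr]
      have e : d - m = d - (m + 1) + 1 := by omega
      rw [e]
      exact (Run.push' (update_tmp _ _ _ _ _ _ _ (d - (m + 1) + 1))).seq (h _ (by omega) _ _))
  have h2 := Run.drain_replicate (k := tmp) (f := fun _ => push ctr true) (B := 1)
    (fun m => conf i (A d) s (d - m) l m n) (N := d)
    (fun m _ => rfl) (fun m hm => by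
      simp only [update_tmp]
      have e : d - m = d - (m + 1) + 1 := by omega
      rw [e]
      exact Run.push' (update_ctr _ _ _ _ _ _ _ (d - (m + 1) + 1)))
  simp only [Nat.sub_self, Nat.sub_zero] at h1 h2
  refine (h1.seq h2).mono (le_of_eq ?_)
  ring

theorem run_forMarks_len {p : StackProg Stack} (l : ℕ → ℕ) {B : ℕ}
    (h : ∀ m < n, ∀ r t, p.Run (conf i a s d (l m) t r) (conf i a s d (l (m + 1)) t r) B) :
    (forMarks len p).Run (conf i a s d (l 0) 0 n) (conf i a s d (l n) 0 n) (n * (B + 4) + 2) := by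
  have h1 := Run.drain_replicate (k := len) (f := fun _ => seq (push tmp true) p) (B := 1 + B)
    (fun m => conf i a s d (l (n - m)) (n - m) m) (N := n)
    (fun m _ => rfl) (fun m hm => by
      simp only [update_len]
      have e : n - m = n - (m + 1) + 1 := by omega
      rw [e]
      exact (Run.push' (update_tmp _ _ _ _ _ _ _ (n - (m + 1) + 1))).seq (h _ (by omega) _ _))
  have h2 := Run.drain_replicate (k := tmp) (f := fun _ => push len true) (B := 1)
    (fun m => conf i a s d (l n) m (n - m)) (N := n)
    (fun m _ => rfl) (fun m hm => by
      simp only [update_tmp]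
      have e : n - m = n - (m + 1) + 1 := by omega
      rw [e]
      exact Run.push' (update_len _ _ _ _ _ _ _ (n - (m + 1) + 1)))
  simp only [Nat.sub_self, Nat.sub_zero] at h1 h2
  refine (h1.seq h2).mono (le_of_eq ?_)
  ring

theorem run_rep_push (c : ℕ) (b : Bool) (t : ℕ) :
    (rep c (push aux b)).Run (conf i a s d l t n) (conf i (List.replicate c b ++ a) s d l t n)
      (c + 1) :=
  (Run.rep (fun m => conf i (List.replicate m b ++ a) s d l t n) (B := 1)
    fun m _ => Run.push' (update_aux _ _ _ _ _ _ _ _)).mono (by omega)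

theorem run_emit_sp (c : ℕ) (b : Bool) :
    (forMarks sp (rep c (push aux b))).Run (conf i a s d l 0 n)
      (conf i (List.replicate (c * s) b ++ a) s d l 0 n) (s * (c + 5) + 2) := by
  have := run_forMarks_sp (s := s) (d := d) (n := n) (fun _ => i)
    (fun m => List.replicate (c * m) b ++ a) (fun _ => l) (p := rep c (push aux b)) (B := c + 1)
    fun m _ r t => by
      rw [Nat.mul_succ, add_comm, List.replicate_add, List.append_assoc]
      exact run_rep_push c b t
  simpa [add_assoc] using this

theorem run_emit_ctr (c : ℕ) (b : Bool) :
    (forMarks ctr (rep c (push aux b))).Run (conf i a s d l 0 n)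
      (conf i (List.replicate (c * d) b ++ a) s d l 0 n) (d * (c + 5) + 2) := by
  have := run_forMarks_ctr (i := i) (s := s) (d := d) (l := l) (n := n)
    (fun m => List.replicate (c * m) b ++ a) (p := rep c (push aux b)) (B := c + 1)
    fun m _ r t => by
      rw [Nat.mul_succ, add_comm, List.replicate_add, List.append_assoc]
      exact run_rep_push c b t
  simpa [add_assoc] using this

/-- Writes the unary code of an affine expression. -/
def emitAffine (c : ℕ × ℕ × ℕ) : StackProg Stack :=
  seq (forMarks sp (rep c.1 (push aux true))) (seq (forMarks ctr (rep c.2.1 (push aux true)))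
    (seq (rep c.2.2 (push aux true)) (push aux false)))

theorem run_emitAffine (c : ℕ × ℕ × ℕ) :
    (emitAffine c).Run (conf i a s d l 0 n) (conf i ((affineCode s d c).reverse ++ a) s d l 0 n)
      ((c.1 + c.2.1 + c.2.2 + 11) * (s + d + 1)) := by
  refine ((run_emit_sp c.1 true).seq ((run_emit_ctr c.2.1 true).seq ((run_rep_push c.2.2 true
    0).seq (Run.push' (s' := conf i ((affineCode s d c).reverse ++ a) s d l 0 n) ?_)))).mono ?_
  · rw [update_aux]
    congr 1
    simp only [conf, affineCode, unary, List.reverse_append, List.reverse_replicate,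
      List.reverse_singleton, List.replicate_add, List.append_assoc, List.cons_append]
    simp only [← List.append_assoc, ← List.replicate_add]
    congr 3
  · nlinarith [Nat.zero_le (c.1 * d), Nat.zero_le (c.2.1 * s), Nat.zero_le (c.2.2 * (s + d))]

/-- Writes a list of unary codes of affine expressions. -/
def emitList (cs : List (ℕ × ℕ × ℕ)) : StackProg Stack :=
  cs.foldr (fun c p => seq (emitAffine c) p) skip

theorem exists_run_emitList (cs : List (ℕ × ℕ × ℕ)) : ∃ B, ∀ (i a : List Bool) (s d l n : ℕ),
    (emitList cs).Run (conf i a s d l 0 n)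
      (conf i ((cs.flatMap (affineCode s d)).reverse ++ a) s d l 0 n) (B * (s + d + 1)) := by
  induction cs with
  | nil => exact ⟨1, fun i a s d l n => (Run.skip _).mono (by omega)⟩
  | cons c cs ih =>
    obtain ⟨B, hB⟩ := ih
    refine ⟨c.1 + c.2.1 + c.2.2 + 11 + B, fun i a s d l n => ?_⟩
    have := (run_emitAffine c).seq (hB i ((affineCode s d c).reverse ++ a) s d l n)
    rw [← add_mul, ← List.append_assoc, ← List.reverse_append, ← List.flatMap_cons] at this
    exact this

/-- Writes fixed bits. -/
def emitBits (bs : List Bool) : StackProg Stack := bs.foldr (fun b p => seq (push aux b) p) skip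

theorem run_emitBits (bs : List Bool) :
    (emitBits bs).Run (conf i a s d l 0 n) (conf i (bs.reverse ++ a) s d l 0 n)
      (bs.length + 1) := by
  induction bs generalizing a with
  | nil => exact Run.skip _
  | cons b bs ih =>
    have := (Run.push' (update_aux i a (b :: a) s d l 0 n)).seq (ih (a := b :: a))
    rw [List.append_cons, ← List.reverse_cons] at this
    exact this.mono (by simp; omega)

/-- Sets the loop counter to the space bound. -/
def setLoop : StackProg Stack := forMarks sp (push loop true)

theorem run_setLoop :
    setLoop.Run (conf i a s d 0 0 n) (conf i a s d s 0 n) (s * 5 + 2) :=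
  run_forMarks_sp (fun _ => i) (fun _ => a) id fun m _ _ _ =>
    Run.push' (update_loop _ _ _ _ _ _ _ (m + 1))

/-- Runs `p` for each mark of the loop counter, and counts the runs. -/
def countLoop (p : StackProg Stack) : StackProg Stack :=
  drain loop fun _ => seq p (push ctr true)

/-- When the counter is `j`, `I j` is the input that is left and `g j` is what the body writes; the
body may consume input. -/
theorem run_countLoop {p : StackProg Stack} (I g : ℕ → List Bool) {B : ℕ} (m : ℕ)
    (h : ∀ j, d ≤ j → j < d + m → ∀ a l,
      p.Run (conf (I j) a s j l 0 n) (conf (I (j + 1)) ((g j).reverse ++ a) s j l 0 n) B) :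
    (countLoop p).Run (conf (I d) a s d m 0 n)
      (conf (I (d + m)) (((List.range m).flatMap fun j => g (d + j)).reverse ++ a) s (d + m) 0 0 n)
      (m * (B + 2) + 1) := by
  induction m generalizing d a with
  | zero => exact (Run.drain_nil rfl).mono (by omega)
  | succ m ih =>
    have hih := ih (d := d + 1) (a := (g d).reverse ++ a) fun j h1 h2 => h j (by omega) (by omega)
    have h1 := h d le_rfl (by omega) a m
    rw [← update_loop (I d) a s d (m + 1) 0 n m] at h1
    have := Run.drain_cons (k := loop) (f := fun _ => seq p (push ctr true)) (b := true)
      (s := conf (I d) a s d (m + 1) 0 n) (l := List.replicate m true) rfl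
      (h1.seq (Run.push' (update_ctr _ _ _ _ _ _ _ (d + 1)))) hih
    have e : ∀ j, d + 1 + j = d + (j + 1) := fun j => by omega
    simp only [e] at this
    rw [List.range_succ_eq_map, List.flatMap_cons, List.flatMap_map, List.reverse_append,
      List.append_assoc]
    refine this.mono ?_
    rw [Nat.succ_mul]
    omega

end StackProg

/-! ### The program that computes the reduction -/

namespace StackProg

open Stack

/-- Writes a block of rows once for every mark of the space bound, with increasing block numbers. -/
def emitBlocks (cs : List (ℕ × ℕ × ℕ)) : StackProg Stack := seq setLoop (countLoop (emitList cs))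

theorem exists_run_emitBlocks (cs : List (ℕ × ℕ × ℕ)) :
    ∃ B, ∀ (i a : List Bool) (s d n : ℕ), d ≤ s + 1 →
      (emitBlocks cs).Run (conf i a s d 0 0 n)
        (conf i (((List.range s).flatMap fun j => cs.flatMap (affineCode s (d + j))).reverse ++ a)
          s (d + s) 0 0 n) (B * (s + 1) ^ 2) := by
  obtain ⟨B, hB⟩ := exists_run_emitList cs
  -- Because `d ≤ s + 1`, the counter is below `2 * s + 1` in every round, so a round of `emitList`
  -- costs at most `3 * B * (s + 1)`.
  refine ⟨3 * B + 8, fun i a s d n hd => ?_⟩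
  refine (run_setLoop.seq (run_countLoop (B := 3 * B * (s + 1)) (fun _ => i)
    (fun j => cs.flatMap (affineCode s j)) s fun j _ hj a l => ?_)).mono ?_
  · refine (hB i a s j l n).mono ?_
    rw [mul_comm 3 B, mul_assoc]
    exact Nat.mul_le_mul_left _ (by omega)
  · nlinarith [Nat.zero_le (B * s)]

/-- Pops an input bit, if there is one, and writes the row for it. -/
def emitRow (r : Option Bool → List (ℕ × ℕ × ℕ)) : StackProg Stack :=
  popCase inp fun o => emitList (r o)

/-- Past the end of the input the pop returns `none`, as `x[d]?` does, so blank cells need no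
special treatment. -/
theorem exists_run_emitRow (r : Option Bool → List (ℕ × ℕ × ℕ)) :
    ∃ B, ∀ (x a : List Bool) (s d l n : ℕ),
      (emitRow r).Run (conf (x.drop d) a s d l 0 n)
        (conf (x.drop (d + 1)) (((r x[d]?).flatMap (affineCode s d)).reverse ++ a) s d l 0 n)
        (B * (s + d + 1)) := by
  choose B hB using fun o => exists_run_emitList (r o)
  refine ⟨∑ o, B o + 1, fun x a s d l n => ?_⟩
  have hp : (emitRow r).Run (conf (x.drop d) a s d l 0 n)
      (conf (x.drop (d + 1)) (((r x[d]?).flatMap (affineCode s d)).reverse ++ a) s d l 0 n)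
      (B x[d]? * (s + d + 1) + 1) := by
    refine Run.popCase ?_
    rw [show conf (x.drop d) a s d l 0 n inp = x.drop d from rfl, update_inp, List.head?_drop,
      List.tail_drop]
    exact hB _ _ _ _ _ _ _
  have : B x[d]? ≤ ∑ o, B o := Finset.single_le_sum (fun _ _ => Nat.zero_le _) (Finset.mem_univ _)
  refine hp.mono ?_
  rw [add_mul]
  exact Nat.add_le_add (Nat.mul_le_mul_right _ this) (by omega)

/-- Writes a row for every mark of the space bound. The rows depend on the input bits, and the
first row is special. -/
def emitRows (r₀ r : Option Bool → List (ℕ × ℕ × ℕ)) : StackProg Stack :=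
  -- The row of cell 0 is already written, so one mark is taken off the loop counter and the block
  -- number starts at 1.
  seq (emitRow r₀) (seq (push ctr true) (seq setLoop (seq (popCase loop fun _ => skip)
    (countLoop (emitRow r)))))

theorem exists_run_emitRows (r₀ r : Option Bool → List (ℕ × ℕ × ℕ)) :
    ∃ B, ∀ (x a : List Bool) (s n : ℕ), 0 < s →
      (emitRows r₀ r).Run (conf x a s 0 0 0 n)
        (conf (x.drop s) (((List.range s).flatMap fun j =>
          (if j = 0 then r₀ x[j]? else r x[j]?).flatMap (affineCode s j)).reverse ++ a) s s 0 0 n)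
        (B * (s + 1) ^ 2) := by
  obtain ⟨B₀, hB₀⟩ := exists_run_emitRow r₀
  obtain ⟨B, hB⟩ := exists_run_emitRow r
  refine ⟨B₀ + 2 * B + 10, fun x a s n hs => ?_⟩
  obtain ⟨s, rfl⟩ : ∃ s', s = s' + 1 := ⟨s - 1, by omega⟩
  have h1 := hB₀ x a (s + 1) 0 0 n
  rw [List.drop_zero] at h1
  have h2 : (popCase loop fun _ => skip).Run (conf (x.drop 1)
      (((r₀ x[0]?).flatMap (affineCode (s + 1) 0)).reverse ++ a) (s + 1) 1 (s + 1) 0 n)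
      (conf (x.drop 1)
      (((r₀ x[0]?).flatMap (affineCode (s + 1) 0)).reverse ++ a) (s + 1) 1 s 0 n) 2 := by
    rw [← update_loop _ _ _ _ (s + 1) _ _ s]
    exact Run.popCase (Run.skip _)
  have h3 := run_countLoop (p := emitRow r) (s := s + 1) (d := 1) (n := n)
    (a := ((r₀ x[0]?).flatMap (affineCode (s + 1) 0)).reverse ++ a) (fun j => x.drop j)
    (fun j => (r x[j]?).flatMap (affineCode (s + 1) j)) (B := 2 * B * (s + 2)) s
    fun j _ hj a l => (hB x a (s + 1) j l n).mono (by
      rw [mul_comm 2 B, mul_assoc]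
      exact Nat.mul_le_mul_left _ (by omega))
  have h4 := h1.seq ((Run.push' (update_ctr _ _ _ _ _ _ _ 1)).seq (run_setLoop.seq (h2.seq h3)))
  rw [List.range_succ_eq_map, List.flatMap_cons, List.flatMap_map, List.reverse_append,
    List.append_assoc]
  simp only [Nat.succ_ne_zero, if_false, if_true, Nat.succ_eq_add_one]
  simp only [add_comm 1] at h4
  refine h4.mono ?_
  nlinarith [Nat.zero_le (B * s), Nat.zero_le (B₀ * s), Nat.zero_le (B₀ * s * s)]

theorem Run.congr {p : StackProg Stack} {s s' s'' : Stack → List Bool} {t t' : ℕ}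
    (h : p.Run s s' t) (hs : s' = s'') (ht : t ≤ t') : p.Run s s'' t' :=
  hs ▸ h.mono ht

/-- Empties a stack. -/
def clear (k : Stack) : StackProg Stack := drain k fun _ => skip

theorem run_clear_ctr {i a : List Bool} {s d l n : ℕ} :
    (clear ctr).Run (conf i a s d l 0 n) (conf i a s 0 l 0 n) (d * 2 + 1) :=
  Run.drain_replicate (fun m => conf i a s m l 0 n) (fun _ _ => rfl) fun m _ => by
    rw [update_ctr]
    exact Run.skip _

theorem run_clear_sp {i a : List Bool} {s d l n : ℕ} :
    (clear sp).Run (conf i a s d l 0 n) (conf i a 0 d l 0 n) (s * 2 + 1) :=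
  Run.drain_replicate (fun m => conf i a m d l 0 n) (fun _ _ => rfl) fun m _ => by
    rw [update_sp]
    exact Run.skip _

theorem run_clear_len {i a : List Bool} {s d l n : ℕ} :
    (clear len).Run (conf i a s d l 0 n) (conf i a s d l 0 0) (n * 2 + 1) :=
  Run.drain_replicate (fun m => conf i a s d l 0 m) (fun _ _ => rfl) fun m _ => by
    rw [update_len]
    exact Run.skip _

theorem run_clear_inp {i a : List Bool} {s d l n : ℕ} :
    (clear inp).Run (conf i a s d l 0 n) (conf [] a s d l 0 n) (i.length * 2 + 1) := by
  induction i with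
  | nil => exact Run.drain_nil rfl
  | cons b i ih =>
    have h : skip.Run (Function.update (conf (b :: i) a s d l 0 n) inp i) (conf i a s d l 0 n) 1 := by
      rw [update_inp]
      exact Run.skip _
    exact (Run.drain_cons (k := inp) (f := fun _ => skip) rfl h ih).mono (by simp; omega)

/-- The stacks when the output is put into the right order. -/
def outConf (a o : List Bool) : Stack → List Bool
  | aux => a
  | out => o
  | _ => []

theorem run_reverse (a o : List Bool) :
    (drain aux fun b => push out b).Run (outConf a o) (outConf [] (a.reverse ++ o))
      (a.length * 2 + 1) := by
  induction a generalizing o with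
  | nil => exact Run.drain_nil rfl
  | cons b a ih =>
    have h : (push out b).Run (Function.update (outConf (b :: a) o) aux a) (outConf a (b :: o)) 1 :=
      Run.push' (by funext k; cases k <;> rfl)
    have := Run.drain_cons (k := aux) (f := fun b => push out b) rfl h (ih (b :: o))
    rw [List.append_cons, ← List.reverse_cons] at this
    exact this.mono (by simp; omega)

/-- Sets the length counter to the length of the input plus `2`, and the space bound to `1`. -/
def measure : StackProg Stack :=
  seq (drain inp fun b => seq (push aux b) (push len true)) (seq (drain aux fun b => push inp b)
    (seq (push len true) (seq (push len true) (push sp true))))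

theorem run_measure (x : List Bool) :
    measure.Run (conf x [] 0 0 0 0 0) (conf x [] 1 0 0 0 (x.length + 2)) (5 * x.length + 5) := by
  have h1 : ∀ (x a : List Bool) (n : ℕ), (drain inp fun b => seq (push aux b) (push len true)).Run
      (conf x a 0 0 0 0 n) (conf [] (x.reverse ++ a) 0 0 0 0 (n + x.length))
      (3 * x.length + 1) := by
    intro x
    induction x with
    | nil => exact fun a n => Run.drain_nil rfl
    | cons b x ih =>
      intro a n
      have h := (Run.push' (update_aux x a (b :: a) 0 0 0 0 n)).seq
        (Run.push' (update_len x (b :: a) 0 0 0 0 n (n + 1)))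
      rw [← update_inp (b :: x) a x] at h
      have := Run.drain_cons (k := inp) (f := fun b => seq (push aux b) (push len true)) rfl h
        (ih (b :: a) (n + 1))
      rw [List.append_cons, ← List.reverse_cons, add_assoc, add_comm 1, ← List.length_cons] at this
      exact this.mono (by simp; omega)
  have h2 : ∀ (a x : List Bool) (n : ℕ), (drain aux fun b => push inp b).Run
      (conf x a 0 0 0 0 n) (conf (a.reverse ++ x) [] 0 0 0 0 n) (2 * a.length + 1) := by
    intro a
    induction a with
    | nil => exact fun x n => Run.drain_nil rfl
    | cons b a ih =>
      intro x n
      have h := Run.push' (update_inp x a (b :: x) 0 0 0 0 n)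
      rw [← update_aux x (b :: a) a] at h
      have := Run.drain_cons (k := aux) (f := fun b => push inp b) rfl h (ih (b :: x) n)
      rw [List.append_cons, ← List.reverse_cons] at this
      exact this.mono (by simp; omega)
  have h3 := h1 x [] 0
  have h4 := h2 x.reverse [] x.length
  rw [List.append_nil, Nat.zero_add] at h3
  rw [List.append_nil, List.reverse_reverse] at h4
  refine (h3.seq (h4.seq ((Run.push' (update_len _ _ _ _ _ _ _ (x.length + 1))).seq
    ((Run.push' (update_len _ _ _ _ _ _ _ (x.length + 2))).seq
      (Run.push' (update_sp _ _ _ _ _ _ _ 1)))))).mono ?_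
  simp
  omega

/-- Multiplies the space bound by the length counter. -/
def multiply : StackProg Stack :=
  seq (drain sp fun _ => forMarks len (push loop true)) (drain loop fun _ => push sp true)

theorem run_multiply {i a : List Bool} {s n : ℕ} :
    multiply.Run (conf i a s 0 0 0 n) (conf i a (s * n) 0 0 0 n) (s * (7 * n + 3) + 2) := by
  have h1 := Run.drain_replicate (k := sp) (f := fun _ => forMarks len (push loop true))
    (fun m => conf i a m 0 ((s - m) * n) 0 n) (N := s) (B := n * 5 + 2) (fun _ _ => rfl)
    fun m hm => by
      simp only [update_sp]
      have e : s - m = s - (m + 1) + 1 := by omega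
      rw [e, Nat.succ_mul]
      exact run_forMarks_len (fun j => (s - (m + 1)) * n + j) fun j _ _ _ =>
        Run.push' (update_loop _ _ _ _ _ _ _ ((s - (m + 1)) * n + j + 1))
  have h2 := Run.drain_replicate (k := loop) (f := fun _ => push sp true)
    (fun m => conf i a (s * n - m) 0 m 0 n) (N := s * n) (B := 1) (fun _ _ => rfl)
    fun m hm => by
      simp only [update_loop]
      have e : s * n - m = s * n - (m + 1) + 1 := by omega
      rw [e]
      exact Run.push' (update_sp _ _ _ _ _ _ _ (s * n - (m + 1) + 1))
  simp only [Nat.sub_self, Nat.sub_zero, Nat.zero_mul] at h1 h2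
  refine (h1.seq h2).mono (le_of_eq ?_)
  ring

theorem run_rep_multiply {i a : List Bool} {n : ℕ} (hn : 0 < n) (k : ℕ) :
    (rep k multiply).Run (conf i a 1 0 0 0 n) (conf i a (n ^ k) 0 0 0 n)
      (k * (n ^ k * (7 * n + 3) + 2) + 1) := by
  have := Run.rep (p := multiply) (fun m => conf i a (n ^ m) 0 0 0 n) (c := k)
    (B := n ^ k * (7 * n + 3) + 2) fun m hm => by
      rw [pow_succ]
      refine run_multiply.mono ?_
      have := Nat.pow_le_pow_right hn hm.le
      gcongr
  simpa using this

end StackProg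

namespace TapeMachine

open StackProg Stack

variable (M : TapeMachine)

/-- Writes the code of an instance up to the table. -/
noncomputable def emitHeader : StackProg Stack :=
  seq (emitList [(0, 0, M.numBits), (0, 0, 1),
      (2 * M.numRecords + 1, 0, 3 * M.numRecords + 1), (2 * M.numRecords + 1, 0, 3 * M.numRecords)])
    (seq (forMarks sp (rep (2 * M.numRecords) (push aux false)))
      (seq (emitBits (List.replicate (3 * M.numRecords) false ++ [true]))
        (seq (forMarks sp (rep 1 (push aux false)))
          (emitBits (List.replicate M.numBits false ++ (true :: unary 1))))))

/-- Writes the table. -/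
noncomputable def emitTable : StackProg Stack :=
  -- The first loop leaves the counter at `S`, the number of the central block; one more mark makes
  -- it the first block on the right.
  seq (emitList M.padRows) (seq (emitBlocks (M.blockRows false)) (seq (emitList (M.blockRows true))
    (seq (push ctr true) (seq (emitBlocks (M.blockRows false)) (seq (clear ctr)
      (seq (emitList M.padRows) (seq (emitList M.sinkRow)
        (emitRows (fun o => M.walkRow o true) fun o => M.walkRow o false))))))))

/-- The program that computes the reduction with the space bound `(|x| + 2) ^ k`. -/
noncomputable def reduction (k : ℕ) : StackProg Stack :=
  seq (seq measure (seq (rep k multiply) (seq M.emitHeader (seq M.emitTable (seq (clear ctr)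
    (seq (clear sp) (seq (clear len) (clear inp)))))))) (drain aux fun b => push out b)

theorem exists_run_emitHeader : ∃ B, ∀ (i a : List Bool) (s n : ℕ),
    M.emitHeader.Run (conf i a s 0 0 0 n)
      (conf i ((unary M.numBits ++ (unary 1 ++
        (affineCode s 0 (2 * M.numRecords + 1, 0, 3 * M.numRecords + 1) ++
        (affineCode s 0 (2 * M.numRecords + 1, 0, 3 * M.numRecords) ++
        (List.replicate (2 * M.numRecords * s + 3 * M.numRecords) false ++ (true ::
        (List.replicate s false ++
        (List.replicate M.numBits false ++ (true :: unary 1))))))))).reverse ++ a) s 0 0 0 n)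
      (B * (s + 1) ^ 2) := by
  obtain ⟨B, hB⟩ := exists_run_emitList [(0, 0, M.numBits), (0, 0, 1),
      (2 * M.numRecords + 1, 0, 3 * M.numRecords + 1), (2 * M.numRecords + 1, 0, 3 * M.numRecords)]
  refine ⟨B + (5 * M.numRecords + M.numBits + 30), fun i a s n => ?_⟩
  have h := (hB i a s 0 0 n).seq ((run_emit_sp (2 * M.numRecords) false).seq
    ((run_emitBits (List.replicate (3 * M.numRecords) false ++ [true])).seq
      ((run_emit_sp 1 false).seq
        (run_emitBits (List.replicate M.numBits false ++ (true :: unary 1))))))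
  refine h.congr (congrArg (fun b => conf i b s 0 0 0 n) ?_) ?_
  · have e : ∀ m, affineCode s 0 (0, 0, m) = unary m := by simp [affineCode]
    simp only [List.flatMap_cons, List.flatMap_nil, e, List.reverse_append, List.reverse_cons,
      List.reverse_replicate, List.append_assoc, List.replicate_add, one_mul, List.reverse_nil,
      List.nil_append, List.append_nil]
  · simp [unary]
    nlinarith [Nat.zero_le (B * s), Nat.zero_le (B * s * s), Nat.zero_le (M.numRecords * s),
      Nat.zero_le (M.numRecords * s * s), Nat.zero_le (M.numBits * s),
      Nat.zero_le (M.numBits * s * s)]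

theorem exists_run_emitTable : ∃ B, ∀ (x a : List Bool) (s n : ℕ), 0 < s →
    M.emitTable.Run (conf x a s 0 0 0 n)
      (conf (x.drop s) ((M.tableCode s x).reverse ++ a) s s 0 0 n) (B * (s + 1) ^ 2) := by
  obtain ⟨B₁, h₁⟩ := exists_run_emitList M.padRows
  obtain ⟨B₂, h₂⟩ := exists_run_emitBlocks (M.blockRows false)
  obtain ⟨B₃, h₃⟩ := exists_run_emitList (M.blockRows true)
  obtain ⟨B₄, h₄⟩ := exists_run_emitList M.sinkRow
  obtain ⟨B₅, h₅⟩ := exists_run_emitRows (fun o => M.walkRow o true) fun o => M.walkRow o false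
  refine ⟨2 * B₁ + 2 * B₂ + 2 * B₃ + B₄ + B₅ + 10, fun x a s n hs => ?_⟩
  have h := (h₁ x a s 0 0 n).seq ((h₂ x _ s 0 n (by omega)).seq ((h₃ x _ s (0 + s) 0 n).seq
    ((Run.push' (update_ctr _ _ _ _ _ _ _ (0 + s + 1))).seq ((h₂ x _ s (0 + s + 1) n (by omega)).seq
      (run_clear_ctr.seq ((h₁ x _ s 0 0 n).seq ((h₄ x _ s 0 0 n).seq (h₅ x _ s n hs))))))))
  refine h.congr (congrArg (fun b => conf (x.drop s) b s s 0 0 n) ?_) ?_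
  · have e : ∀ i, (if i = 0 then M.walkRow x[i]? true else M.walkRow x[i]? false) =
        M.walkRow x[i]? (decide (i = 0)) := by
      intro i
      split_ifs with hi <;> simp [hi]
    simp [tableCode, e]
  · nlinarith [Nat.zero_le (B₁ * s), Nat.zero_le (B₁ * s * s), Nat.zero_le (B₃ * s),
      Nat.zero_le (B₃ * s * s), Nat.zero_le (B₄ * s), Nat.zero_le (B₄ * s * s)]

theorem exists_run_reduction (k : ℕ) : ∃ T : Polynomial ℕ, ∀ (x : List Bool)
    (hS : 0 < (x.length + 2) ^ k),
    (M.reduction k).Run (Function.update (fun _ => []) inp x)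
      (Function.update (fun _ => []) out (M.hidingInput x hS).encode) (T.eval x.length) := by
  obtain ⟨B₁, h₁⟩ := M.exists_run_emitHeader
  obtain ⟨B₂, h₂⟩ := M.exists_run_emitTable
  -- The output is no longer than the time used to write it, and its reversal takes two steps per
  -- bit; hence the factor 3.
  refine ⟨3 * (5 * .X + 5 + (k * ((.X + 2) ^ k * (7 * (.X + 2) + 3) + 2) + 1) +
    B₁ * ((.X + 2) ^ k + 1) ^ 2 + B₂ * ((.X + 2) ^ k + 1) ^ 2 + (4 * (.X + 2) ^ k + 4 * .X + 20)),
    fun x hS => ?_⟩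
  have h := (run_measure x).seq ((run_rep_multiply (by omega) k).seq
    ((h₁ x [] ((x.length + 2) ^ k) (x.length + 2)).seq
      ((h₂ x _ ((x.length + 2) ^ k) (x.length + 2) hS).seq (run_clear_ctr.seq
        (run_clear_sp.seq (run_clear_len.seq run_clear_inp))))))
  have hcode := encode_hidingInput (M := M) x hS
  simp only [← List.append_assoc, ← List.cons_append] at hcode
  rw [List.append_nil, ← List.reverse_append] at h
  simp only [← List.append_assoc, ← List.cons_append] at h
  rw [← hcode] at h
  have hlen := h.length_le aux
  have h0 : ∀ b, conf [] b 0 0 0 0 0 = outConf b [] := fun b => by funext k; cases k <;> rfl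
  rw [h0] at h
  have hin : conf x [] 0 0 0 0 0 = Function.update (fun _ => []) inp x := by
    funext k; cases k <;> rfl
  have hout : ∀ b, outConf [] b = Function.update (fun _ => []) out b := fun b => by
    funext k; cases k <;> rfl
  have hall := h.seq (run_reverse _ [])
  rw [List.append_nil, List.reverse_reverse, hin, hout] at hall
  refine hall.mono ?_
  have hdrop : (x.drop ((x.length + 2) ^ k)).length ≤ x.length := by simp
  simp only [conf, List.length_nil, zero_add] at hlen
  simp only [Polynomial.eval_mul, Polynomial.eval_add, Polynomial.eval_pow, Polynomial.eval_X,
    Polynomial.eval_natCast, Polynomial.eval_ofNat, Polynomial.eval_one]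
  simp only [Nat.cast_id]
  generalize (x.length + 2) ^ k = s at *
  generalize M.hidingInput x hS = y at *
  omega

end TapeMachine

/-! ### Hardness for arbitrary polynomial space bounds -/

/-- Every polynomial is bounded by a power of `n + 2`. -/
theorem Polynomial.exists_eval_le_pow (p : Polynomial ℕ) :
    ∃ k : ℕ, ∀ n : ℕ, p.eval n ≤ (n + 2) ^ k := by
  induction p using Polynomial.induction_on' with
  | add p q hp hq =>
    obtain ⟨k, hk⟩ := hp
    obtain ⟨l, hl⟩ := hq
    refine ⟨k + l + 1, fun n => ?_⟩
    have h1 : (n + 2) ^ k ≤ (n + 2) ^ (k + l) := Nat.pow_le_pow_right (by omega) (by omega)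
    have h2 : (n + 2) ^ l ≤ (n + 2) ^ (k + l) := Nat.pow_le_pow_right (by omega) (by omega)
    rw [Polynomial.eval_add, pow_succ]
    nlinarith [hk n, hl n, Nat.zero_le ((n + 2) ^ (k + l) * n)]
  | monomial m c =>
    refine ⟨c + m, fun n => ?_⟩
    rw [Polynomial.eval_monomial, pow_add]
    -- The base exceeds 1 even for `n = 0`, so a power of it absorbs the coefficient.
    have h1 : c ≤ (n + 2) ^ c := (Nat.lt_pow_self (by omega)).le
    have h2 : n ^ m ≤ (n + 2) ^ m := Nat.pow_le_pow_left (by omega) m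
    exact Nat.mul_le_mul h1 h2

/-- Bounded hiding of a DBW secret is PSPACE-hard, and it is so for the inputs with bound `1`. -/
theorem theorem4p2 :
    PSPACEHard HidingInput.encode HidingInput.Holds ∧
    PSPACEHard (fun x : {x : HidingInput // x.bound = 1} => x.1.encode) (fun x => x.1.Holds) := by
  -- Computability depends only on the output string. Quantifying over the type of instances lets
  -- one program serve both the full problem and the restricted one.
  have key : ∀ L ∈ PSPACE, ∃ f : List Bool → {x : HidingInput // x.bound = 1},
      (∀ β (enc : β → List Bool) (g : List Bool → β), (∀ x, enc (g x) = (f x).1.encode) →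
        Nonempty (TM2ComputableInPolyTime (id : List Bool → List Bool) enc g)) ∧
      ∀ x, x ∈ L ↔ (f x).1.Holds := by
    rintro L ⟨M, p, hM⟩
    obtain ⟨k, hk⟩ := p.exists_eval_le_pow
    obtain ⟨T, hT⟩ := M.exists_run_reduction k
    have hS : ∀ x : List Bool, 0 < (x.length + 2) ^ k := fun x => Nat.pow_pos (by omega)
    refine ⟨fun x => ⟨M.hidingInput x (hS x), rfl⟩, fun β enc g hg => ?_, fun x => ?_⟩
    · refine StackProg.nonempty_computableInPolyTime (M.reduction k) .inp .out T fun x => ?_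
      rw [hg]
      exact hT x (hS x)
    · exact (hM.holds_hidingInput_iff (hk _) (hS x)).symm
  constructor
  · intro L hL
    obtain ⟨f, hf, hx⟩ := key L hL
    exact ⟨fun x => (f x).1, hf _ _ _ fun _ => rfl, hx⟩
  · intro L hL
    obtain ⟨f, hf, hx⟩ := key L hL
    exact ⟨f, hf _ _ _ fun _ => rfl, hx⟩
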